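/- Let $N\ge 1$, let $\Omega\subset\mathbb{R}^N$ be a bounded open set, $T>0$, $Q=\Omega\times\,]0,T[$, $Y=(-\tfrac12,\tfrac12)^N$ and $Z=(-\tfrac12,\tfrac12)$; all functions are real-valued. Let $a_{ij}\in L^\infty(\mathbb{R}^N)$ $(1\le i,j\le N)$ satisfy $a_{ij}=a_{ji}$ and, for some $\alpha>0$ and almost every $y\in\mathbb{R}^N$, $$\sum_{i,j=1}^N a_{ij}(y)\,\zeta_j\zeta_i\ \ge\ \alpha|\zeta|^2\qquad\text{for all }\zeta\in\mathbb{R}^N .$$ Let $V=\{\mathbf{u}\in H_0^1(\Omega)^N:\operatorname{div}\mathbf{u}=0\}$, with topological dual $V'$, and $$\mathcal{W}(0,T)=\{\mathbf{u}\in L^2(0,T;V):\mathbf{u}'\in L^2(0,T;V')\},$$ where $\mathbf{u}'$ is the distributional derivative on $]0,T[$ and $V$ is embedded in $V'$ through the scalar product of $L^2(\Omega)^N$; elements of $\mathcal{W}(0,T)$ are continuous on $[0,T]$ with values in $L^2(\Omega)^N$. Let $H^1_\#(Y)$ be the space of $Y$-periodic functions $w\in H^1_{loc}(\mathbb{R}^N)$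 with $\int_Y w\,dy=0$, let $V_Y=\{\mathbf{w}\in H^1_\#(Y)^N:\operatorname{div}_y\mathbf{w}=0\}$, let $L^2_{per}(Z;V_Y)$ be the space of $1$-periodic functions of $\tau\in\mathbb{R}$ with values in $V_Y$ that are square integrable over $Z$, and let $$\mathbb{F}_0^1=L^2(0,T;V)\times L^2\big(Q;L^2_{per}(Z;V_Y)\big).$$ For $\mathbf{u}=(\mathbf{u}_0,\mathbf{u}_1)$ and $\mathbf{v}=(\mathbf{v}_0,\mathbf{v}_1)$ in $V\times L^2(\Omega;L^2_{per}(Z;V_Y))$ put $$\widehat a_\Omega(\mathbf{u},\mathbf{v})=\sum_{i,j,k=1}^N\iiint_{\Omega\times Y\times Z}a_{ij}(y)\Big(\frac{\partial u_0^k}{\partial x_j}+\frac{\partial u_1^k}{\partial y_j}\Big)\Big(\frac{\partial v_0^k}{\partial x_i}+\frac{\partial v_1^k}{\partial y_i}\Big)\,dx\,dy\,d\tau .$$ Let $\mathbf{f}\in L^2(0,T;H^{-1}(\Omega)^N)$. Then there is at most one $\mathbf{u}=(\mathbf{u}_0,\mathbf{u}_1)\in\mathbb{F}_0^1$ such that $\mathbf{u}_0\in\mathcal{W}(0,T)$,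 $\mathbf{u}_0(0)=0$ and $$\int_0^T(\mathbf{u}_0'(t),\mathbf{v}_0(t))\,dt+\int_0^T\widehat a_\Omega(\mathbf{u}(t),\mathbf{v}(t))\,dt=\int_0^T(\mathbf{f}(t),\mathbf{v}_0(t))\,dt\qquad\text{for all }\mathbf{v}=(\mathbf{v}_0,\mathbf{v}_1)\in\mathbb{F}_0^1 .$$ -/

import Mathlib

open MeasureTheory Set
open scoped ENNReal ContDiff RealInnerProductSpace

noncomputable section

/-- The Euclidean space `ℝ^N`. -/
abbrev RN (N : ℕ) : Type := EuclideanSpace ℝ (Fin N)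

/-- The space `𝒟(U; ℝ)` of real test functions on an open set `U`, as a predicate. -/
def IsTestFun {F : Type*} [NormedAddCommGroup F] [NormedSpace ℝ F] (U : Set F) (φ : F → ℝ) :
    Prop :=
  ContDiff ℝ ∞ φ ∧ HasCompactSupport φ ∧ tsupport φ ⊆ U

/-- The Hilbert space `L²(D) × L²(D)^N` in which the pairs `(u, ∇u)` live: a function of a
Sobolev space on `D` is recorded together with its (unique) weak gradient, so that the norm
is the `H¹(D)` norm `(‖u‖² + ‖∇u‖²)^(1/2)`. -/
abbrev JetL2 (N : ℕ) (D : Set (RN N)) : Type :=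
  WithLp 2 (Lp ℝ 2 (volume.restrict D) × Lp (RN N) 2 (volume.restrict D))

/-! ### `H₀¹(Ω; ℝ)`, its dual, and the space `V` -/

/-- `H₀¹(Ω; ℝ)`: the closure of `𝒟(Ω; ℝ)` in the `H¹(Ω)` norm. -/
def H10 {N : ℕ} (Ω : Set (RN N)) : Submodule ℝ (JetL2 N Ω) :=
  (Submodule.span ℝ {p : JetL2 N Ω | ∃ φ : RN N → ℝ, IsTestFun Ω φ ∧
    p.fst =ᵐ[volume.restrict Ω] φ ∧ p.snd =ᵐ[volume.restrict Ω] gradient φ}).topologicalClosure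

instance H10.instNormedAddCommGroup {N : ℕ} (Ω : Set (RN N)) : NormedAddCommGroup (H10 Ω) :=
  Submodule.normedAddCommGroup _

instance H10.instInnerProductSpace {N : ℕ} (Ω : Set (RN N)) : InnerProductSpace ℝ (H10 Ω) :=
  Submodule.innerProductSpace _

instance H10.instNormedSpace {N : ℕ} (Ω : Set (RN N)) : NormedSpace ℝ (H10 Ω) :=
  InnerProductSpace.toNormedSpace

/-- `H₀¹(Ω; ℝ)^N`. -/
abbrev H10N {N : ℕ} (Ω : Set (RN N)) : Type := PiLp 2 (fun _ : Fin N => H10 Ω)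

instance H10N.instNormedAddCommGroup {N : ℕ} (Ω : Set (RN N)) : NormedAddCommGroup (H10N Ω) :=
  PiLp.normedAddCommGroup 2 _

instance H10N.instInnerProductSpace {N : ℕ} (Ω : Set (RN N)) : InnerProductSpace ℝ (H10N Ω) :=
  PiLp.innerProductSpace _

instance H10N.instNormedSpace {N : ℕ} (Ω : Set (RN N)) : NormedSpace ℝ (H10N Ω) :=
  InnerProductSpace.toNormedSpace

/-- `H⁻¹(Ω; ℝ)^N`, with `H⁻¹(Ω; ℝ)` the topological dual of `H₀¹(Ω; ℝ)`. -/
abbrev Hm1N {N : ℕ} (Ω : Set (RN N)) : Type :=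
  PiLp 2 (fun _ : Fin N => StrongDual ℝ (H10 Ω))

/-- The component `u^k ∈ L²(Ω)` of `u ∈ H₀¹(Ω)^N`. -/
def H10N.comp {N : ℕ} {Ω : Set (RN N)} (u : H10N Ω) (k : Fin N) :
    Lp ℝ 2 (volume.restrict Ω) := (u k : JetL2 N Ω).fst

/-- The gradient `∇u^k ∈ L²(Ω)^N` of the component `u^k` of `u ∈ H₀¹(Ω)^N`. -/
def H10N.grad {N : ℕ} {Ω : Set (RN N)} (u : H10N Ω) (k : Fin N) :
    Lp (RN N) 2 (volume.restrict Ω) := (u k : JetL2 N Ω).snd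

/-- `V = {u ∈ H₀¹(Ω; ℝ)^N : div u = 0}`, with the norm of `H₀¹(Ω; ℝ)^N`. -/
def VDivSub {N : ℕ} (Ω : Set (RN N)) : Submodule ℝ (H10N Ω) where
  carrier := {u | ∀ᵐ x ∂(volume.restrict Ω), ∑ k, (u.grad k x) k = 0}
  zero_mem' := by
    have h : ∀ᵐ x ∂(volume.restrict Ω), (0 : Lp (RN N) 2 (volume.restrict Ω)) x = 0 :=
      Lp.coeFn_zero _ _ _
    filter_upwards [h] with x hx
    refine Finset.sum_eq_zero fun k _ => ?_
    change ((0 : Lp (RN N) 2 (volume.restrict Ω)) x) k = 0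
    rw [hx]; rfl
  add_mem' := by
    intro u v hu hv
    have h : ∀ k, ∀ᵐ x ∂(volume.restrict Ω),
        H10N.grad (u + v) k x = u.grad k x + v.grad k x := fun k =>
      Lp.coeFn_add (u.grad k) (v.grad k)
    filter_upwards [hu, hv, ae_all_iff.2 h] with x h1 h2 h3
    simp [h3, Finset.sum_add_distrib, h1, h2]
  smul_mem' := by
    intro c u hu
    have h : ∀ k, ∀ᵐ x ∂(volume.restrict Ω),
        H10N.grad (c • u) k x = c • u.grad k x := fun k =>
      Lp.coeFn_smul c (u.grad k)
    filter_upwards [hu, ae_all_iff.2 h] with x h1 h3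
    simp [h3, ← Finset.mul_sum, h1]

/-- The Hilbert space `V = {u ∈ H₀¹(Ω; ℝ)^N : div u = 0}`, as a type. -/
def VDiv {N : ℕ} (Ω : Set (RN N)) : Type := VDivSub Ω

instance VDiv.instNormedAddCommGroup {N : ℕ} (Ω : Set (RN N)) : NormedAddCommGroup (VDiv Ω) :=
  Submodule.normedAddCommGroup (VDivSub Ω)

instance VDiv.instInnerProductSpace {N : ℕ} (Ω : Set (RN N)) : InnerProductSpace ℝ (VDiv Ω) :=
  Submodule.innerProductSpace (VDivSub Ω)

instance VDiv.instNormedSpace {N : ℕ} (Ω : Set (RN N)) : NormedSpace ℝ (VDiv Ω) :=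
  InnerProductSpace.toNormedSpace

/-- The inclusion of `VDiv` in `H10N`. -/
def VDiv.incl {N : ℕ} {Ω : Set (RN N)} : VDiv Ω →L[ℝ] H10N Ω := (VDivSub Ω).subtypeL

/-- The scalar product of `L²(Ω)^N`, on `V`. -/
def VDiv.innerL2 {N : ℕ} {Ω : Set (RN N)} (u v : VDiv Ω) : ℝ :=
  ∑ k, ⟪u.incl.comp k, v.incl.comp k⟫

/-! ### `H¹_#(Y; ℝ)` and the space `V_Y` -/

/-- The unit cell `Y = (-1/2, 1/2)^N`. -/
def cellY (N : ℕ) : Set (RN N) := {y | ∀ i, y i ∈ Ioo (-(1 / 2) : ℝ) (1 / 2)}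

/-- `F`-valued functions in `L²_loc(ℝ^N; F)`. -/
def MemL2loc {N : ℕ} {F : Type*} [NormedAddCommGroup F] (w : RN N → F) : Prop :=
  ∀ K : Set (RN N), IsCompact K → MemLp w 2 (volume.restrict K)

/-- `w ∈ H¹_loc(ℝ^N; ℝ)` with weak gradient `G`. -/
structure IsH1loc {N : ℕ} (w : RN N → ℝ) (G : RN N → RN N) : Prop where
  memL2loc : MemL2loc w
  memL2loc_grad : MemL2loc G
  weakGrad : ∀ φ : RN N → ℝ, IsTestFun univ φ → ∀ i : Fin N,
    ∫ y, w y * gradient φ y i = - ∫ y, G y i * φ y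

/-- `w(y + k) = w(y)` for almost every `y`, for each `k ∈ ℤ^N`. -/
def IsYPeriodic {N : ℕ} (w : RN N → ℝ) : Prop :=
  ∀ k : Fin N → ℤ, ∀ᵐ y : RN N, w (y + WithLp.toLp 2 (fun i => (k i : ℝ))) = w y

theorem MemL2loc.locallyIntegrable {N : ℕ} {F : Type*} [NormedAddCommGroup F]
    {w : RN N → F} (hw : MemL2loc w) : LocallyIntegrable w volume := by
  rw [locallyIntegrable_iff]
  intro K hK
  have : IsFiniteMeasure (volume.restrict K) := ⟨by simpa using hK.measure_lt_top⟩
  exact (hw K hK).integrable (by norm_num)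

theorem IsTestFun.continuous_gradient {N : ℕ} {φ : RN N → ℝ} (hφ : IsTestFun univ φ) :
    Continuous (gradient φ) :=
  (InnerProductSpace.toDual ℝ (RN N)).symm.continuous.comp
    (hφ.1.continuous_fderiv (by simp))

theorem IsTestFun.hasCompactSupport_gradient {N : ℕ} {φ : RN N → ℝ} (hφ : IsTestFun univ φ) :
    HasCompactSupport (gradient φ) :=
  (hφ.2.1.fderiv (𝕜 := ℝ)).comp_left (g := (InnerProductSpace.toDual ℝ (RN N)).symm)
    (map_zero _)

theorem IsH1loc.integrable_left {N : ℕ} {w : RN N → ℝ} {G : RN N → RN N} (h : IsH1loc w G)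
    {φ : RN N → ℝ} (hφ : IsTestFun univ φ) (i : Fin N) :
    Integrable (fun y => w y * gradient φ y i) := by
  have hc : Continuous fun y => gradient φ y i :=
    (EuclideanSpace.proj (𝕜 := ℝ) i).continuous.comp hφ.continuous_gradient
  have hs : HasCompactSupport fun y => gradient φ y i :=
    hφ.hasCompactSupport_gradient.comp_left (g := fun z : RN N => z i) rfl
  simpa [mul_comm] using
    h.memL2loc.locallyIntegrable.integrable_smul_left_of_hasCompactSupport hc hs

theorem IsH1loc.integrable_right {N : ℕ} {w : RN N → ℝ} {G : RN N → RN N} (h : IsH1loc w G)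
    {φ : RN N → ℝ} (hφ : IsTestFun univ φ) (i : Fin N) :
    Integrable (fun y => G y i * φ y) := by
  have hG := h.memL2loc_grad.locallyIntegrable.integrable_smul_left_of_hasCompactSupport
    hφ.1.continuous hφ.2.1
  simpa [mul_comm] using (EuclideanSpace.proj (𝕜 := ℝ) i).integrable_comp hG

theorem IsH1loc.zero {N : ℕ} : IsH1loc (fun _ : RN N => (0 : ℝ)) (fun _ => 0) where
  memL2loc _ _ := MemLp.zero
  memL2loc_grad _ _ := MemLp.zero
  weakGrad φ _ i := by simp

theorem IsH1loc.add {N : ℕ} {w w' : RN N → ℝ} {G G' : RN N → RN N} (h : IsH1loc w G)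
    (h' : IsH1loc w' G') : IsH1loc (fun y => w y + w' y) (fun y => G y + G' y) where
  memL2loc K hK := (h.memL2loc K hK).add (h'.memL2loc K hK)
  memL2loc_grad K hK := (h.memL2loc_grad K hK).add (h'.memL2loc_grad K hK)
  weakGrad φ hφ i := by
    simp only [PiLp.add_apply, add_mul]
    rw [integral_add (h.integrable_left hφ i) (h'.integrable_left hφ i),
      integral_add (h.integrable_right hφ i) (h'.integrable_right hφ i),
      h.weakGrad φ hφ i, h'.weakGrad φ hφ i, neg_add]

theorem IsH1loc.smul {N : ℕ} {w : RN N → ℝ} {G : RN N → RN N} (c : ℝ) (h : IsH1loc w G) :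
    IsH1loc (fun y => c * w y) (fun y => c • G y) where
  memL2loc K hK := (h.memL2loc K hK).const_mul c
  memL2loc_grad K hK := (h.memL2loc_grad K hK).const_smul c
  weakGrad φ hφ i := by
    simp only [PiLp.smul_apply, smul_eq_mul, mul_assoc]
    rw [integral_const_mul, integral_const_mul, h.weakGrad φ hφ i, mul_neg]

/-- `H¹_#(Y; ℝ)`: the `Y`-periodic functions `w ∈ H¹_loc(ℝ^N; ℝ)` with `∫_Y w = 0`. Such a
function (and its gradient, which is then `Y`-periodic too) is determined by its restriction
to `Y`, and is recorded by the restriction of `(w, ∇w)` to `Y`. The norm is the one of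
`H¹(Y)`, which is equivalent to the gradient norm on this space. -/
def HSharp (N : ℕ) : Submodule ℝ (JetL2 N (cellY N)) where
  carrier := {p | ∃ (w : RN N → ℝ) (G : RN N → RN N), IsH1loc w G ∧ IsYPeriodic w ∧
    p.fst =ᵐ[volume.restrict (cellY N)] w ∧ p.snd =ᵐ[volume.restrict (cellY N)] G ∧
    ∫ y in cellY N, p.fst y = 0}
  zero_mem' := by
    have h0 : ((0 : Lp ℝ 2 (volume.restrict (cellY N))) : RN N → ℝ)
        =ᵐ[volume.restrict (cellY N)] fun _ => 0 := Lp.coeFn_zero _ _ _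
    refine ⟨fun _ => 0, fun _ => 0, IsH1loc.zero, fun k => Filter.Eventually.of_forall
      fun _ => rfl, h0, Lp.coeFn_zero _ _ _, ?_⟩
    exact (integral_congr_ae h0).trans (by simp)
  add_mem' := by
    rintro p q ⟨w, G, h, hper, hw, hG, hi⟩ ⟨w', G', h', hper', hw', hG', hi'⟩
    have hfin : IsFiniteMeasure (volume.restrict (cellY N)) := by
      refine ⟨?_⟩
      rw [Measure.restrict_apply_univ]
      refine Bornology.IsBounded.measure_lt_top ?_
      refine (PiLp.antilipschitzWith_ofLp 2 (fun _ : Fin N => ℝ)).isBounded_preimage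
        (s := Set.pi univ fun _ => Ioo (-(1 / 2) : ℝ) (1 / 2))
        (Bornology.IsBounded.pi fun _ => Metric.isBounded_Ioo _ _) |>.subset ?_
      intro y hy i _
      exact hy i
    have hadd : ((p + q).fst : RN N → ℝ) =ᵐ[volume.restrict (cellY N)]
        fun y => p.fst y + q.fst y := Lp.coeFn_add p.fst q.fst
    have hadd' : ((p + q).snd : RN N → RN N) =ᵐ[volume.restrict (cellY N)]
        fun y => p.snd y + q.snd y := Lp.coeFn_add p.snd q.snd
    refine ⟨_, _, h.add h', fun k => ?_, hadd.trans (hw.add hw'), hadd'.trans (hG.add hG'), ?_⟩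
    · filter_upwards [hper k, hper' k] with y h1 h2
      rw [h1, h2]
    · rw [integral_congr_ae hadd, integral_add, hi, hi', add_zero]
      · exact (Lp.memLp p.fst).integrable (by norm_num)
      · exact (Lp.memLp q.fst).integrable (by norm_num)
  smul_mem' := by
    rintro c p ⟨w, G, h, hper, hw, hG, hi⟩
    have hs : ((c • p).fst : RN N → ℝ) =ᵐ[volume.restrict (cellY N)]
        fun y => c * p.fst y := Lp.coeFn_smul c p.fst
    have hs' : ((c • p).snd : RN N → RN N) =ᵐ[volume.restrict (cellY N)]
        fun y => c • p.snd y := Lp.coeFn_smul c p.snd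
    refine ⟨_, _, h.smul c, fun k => ?_, hs.trans ?_, hs'.trans (hG.const_smul c), ?_⟩
    · filter_upwards [hper k] with y h1
      rw [h1]
    · filter_upwards [hw] with y h1
      rw [h1]
    · rw [integral_congr_ae hs, integral_const_mul, hi, mul_zero]

instance HSharp.instNormedAddCommGroup (N : ℕ) : NormedAddCommGroup (HSharp N) :=
  Submodule.normedAddCommGroup _

instance HSharp.instInnerProductSpace (N : ℕ) : InnerProductSpace ℝ (HSharp N) :=
  Submodule.innerProductSpace _

instance HSharp.instNormedSpace (N : ℕ) : NormedSpace ℝ (HSharp N) :=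
  InnerProductSpace.toNormedSpace

/-- `H¹_#(Y; ℝ)^N`. -/
abbrev HSharpN (N : ℕ) : Type := PiLp 2 (fun _ : Fin N => HSharp N)

instance HSharpN.instNormedAddCommGroup (N : ℕ) : NormedAddCommGroup (HSharpN N) :=
  PiLp.normedAddCommGroup 2 _

instance HSharpN.instInnerProductSpace (N : ℕ) : InnerProductSpace ℝ (HSharpN N) :=
  PiLp.innerProductSpace _

instance HSharpN.instNormedSpace (N : ℕ) : NormedSpace ℝ (HSharpN N) :=
  InnerProductSpace.toNormedSpace

/-- The gradient `∇_y w^k ∈ L²(Y)^N` of the component `w^k` of `w ∈ H¹_#(Y)^N`. -/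
def HSharpN.grad {N : ℕ} (w : HSharpN N) (k : Fin N) :
    Lp (RN N) 2 (volume.restrict (cellY N)) := (w k : JetL2 N (cellY N)).snd

/-- `V_Y = {w ∈ H¹_#(Y; ℝ)^N : div_y w = 0}`. -/
def VYSub (N : ℕ) : Submodule ℝ (HSharpN N) where
  carrier := {w | ∀ᵐ y ∂(volume.restrict (cellY N)), ∑ k, (w.grad k y) k = 0}
  zero_mem' := by
    have h : ∀ᵐ x ∂(volume.restrict (cellY N)),
        (0 : Lp (RN N) 2 (volume.restrict (cellY N))) x = 0 := Lp.coeFn_zero _ _ _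
    filter_upwards [h] with x hx
    refine Finset.sum_eq_zero fun k _ => ?_
    change ((0 : Lp (RN N) 2 (volume.restrict (cellY N))) x) k = 0
    rw [hx]; rfl
  add_mem' := by
    intro u v hu hv
    have h : ∀ k, ∀ᵐ x ∂(volume.restrict (cellY N)),
        HSharpN.grad (u + v) k x = u.grad k x + v.grad k x := fun k =>
      Lp.coeFn_add (u.grad k) (v.grad k)
    filter_upwards [hu, hv, ae_all_iff.2 h] with x h1 h2 h3
    simp [h3, Finset.sum_add_distrib, h1, h2]
  smul_mem' := by
    intro c u hu
    have h : ∀ k, ∀ᵐ x ∂(volume.restrict (cellY N)),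
        HSharpN.grad (c • u) k x = c • u.grad k x := fun k =>
      Lp.coeFn_smul c (u.grad k)
    filter_upwards [hu, ae_all_iff.2 h] with x h1 h3
    simp [h3, ← Finset.mul_sum, h1]

/-- The Hilbert space `V_Y = {w ∈ H¹_#(Y; ℝ)^N : div_y w = 0}`, as a type. -/
def VY (N : ℕ) : Type := VYSub N

instance VY.instNormedAddCommGroup (N : ℕ) : NormedAddCommGroup (VY N) :=
  Submodule.normedAddCommGroup (VYSub N)

instance VY.instInnerProductSpace (N : ℕ) : InnerProductSpace ℝ (VY N) :=
  Submodule.innerProductSpace (VYSub N)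

instance VY.instNormedSpace (N : ℕ) : NormedSpace ℝ (VY N) :=
  InnerProductSpace.toNormedSpace

/-- The inclusion of `VY` in `HSharpN`. -/
def VY.incl {N : ℕ} : VY N →L[ℝ] HSharpN N := (VYSub N).subtypeL

/-- `L²_per(Z; V_Y)`: the `1`-periodic functions of `τ ∈ ℝ` with values in `V_Y`, square
integrable over the period `Z = (-1/2, 1/2)`, that is, functions on the circle `ℝ / ℤ`, whose
measure is the Lebesgue measure of `Z`. -/
abbrev LperVY (N : ℕ) : Type := Lp (VY N) 2 (volume : Measure UnitAddCircle)

/-! ### The spaces of functions of time -/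

/-- Lebesgue measure on `]0,T[`. -/
abbrev timeMeasure (T : ℝ) : Measure ℝ := volume.restrict (Ioo 0 T)

/-- `L²(0,T; V)`. -/
abbrev L2TV {N : ℕ} (Ω : Set (RN N)) (T : ℝ) : Type := Lp (VDiv Ω) 2 (timeMeasure T)

/-- `L²(0,T; V')`, with `V'` the topological dual of `V`. -/
abbrev L2TVdual {N : ℕ} (Ω : Set (RN N)) (T : ℝ) : Type :=
  Lp (StrongDual ℝ (VDiv Ω)) 2 (timeMeasure T)

/-- `L²(Q; L²_per(Z; V_Y))` with `Q = Ω × ]0,T[`. -/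
abbrev L2QVY {N : ℕ} (Ω : Set (RN N)) (T : ℝ) : Type :=
  Lp (LperVY N) 2 ((volume.restrict Ω).prod (timeMeasure T))

/-- `𝔽₀¹ = L²(0,T; V) × L²(Q; L²_per(Z; V_Y))`. -/
abbrev F01 {N : ℕ} (Ω : Set (RN N)) (T : ℝ) : Type := L2TV Ω T × L2QVY Ω T

/-- `g = u'` in the sense of `V'`-valued distributions on `]0,T[`, where `V` is embedded in `V'`
through the scalar product of `L²(Ω)^N`. -/
def HasTimeDeriv {N : ℕ} {Ω : Set (RN N)} {T : ℝ} (u : L2TV Ω T) (g : L2TVdual Ω T) : Prop :=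
  ∀ φ : ℝ → ℝ, IsTestFun (Ioo 0 T) φ → ∀ v : VDiv Ω,
    ∫ t in Ioo 0 T, deriv φ t * VDiv.innerL2 (u t) v = - ∫ t in Ioo 0 T, φ t * g t v

/-- `u(0) = 0` for `u ∈ 𝒲(0,T) ⊂ 𝒞([0,T]; L²(Ω)^N)`: the continuous representative of `u` with
values in `L²(Ω)^N` vanishes at `t = 0`. -/
def HasZeroInitialValue {N : ℕ} {Ω : Set (RN N)} {T : ℝ} (u : L2TV Ω T) : Prop :=
  ∃ c : ℝ → PiLp 2 (fun _ : Fin N => Lp ℝ 2 (volume.restrict Ω)),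
    ContinuousOn c (Icc 0 T) ∧ c 0 = 0 ∧
    ∀ᵐ t ∂(timeMeasure T), ∀ k, c t k = (u t).incl.comp k

/-! ### The two-scale variational problem -/

/-- The form
`â_Ω(u,v) = ∑_{i,j,k} ∭_{Ω×Y×Z} a_ij (∂u₀^k/∂x_j + ∂u₁^k/∂y_j) (∂v₀^k/∂x_i + ∂v₁^k/∂y_i)`
for `u = (u₀,u₁)` and `v = (v₀,v₁)` in `V × L²(Ω; L²_per(Z; V_Y))`; the second components are
given by any representatives. -/
def aHat {N : ℕ} (Ω : Set (RN N)) (a : Fin N → Fin N → RN N → ℝ)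
    (u₀ : VDiv Ω) (u₁ : RN N → LperVY N) (v₀ : VDiv Ω) (v₁ : RN N → LperVY N) : ℝ :=
  ∑ i, ∑ j, ∑ k, ∫ x in Ω, ∫ τ : UnitAddCircle, ∫ y in cellY N,
    a i j y
      * (u₀.incl.grad k x j + (u₁ x τ).incl.grad k y j)
      * (v₀.incl.grad k x i + (v₁ x τ).incl.grad k y i)

/-- `u = (u₀,u₁) ∈ 𝔽₀¹` solves the two-scale variational problem with right-hand side
`f ∈ L²(0,T; H⁻¹(Ω; ℝ)^N)`: `u₀ ∈ 𝒲(0,T)`, `u₀(0) = 0` and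
`∫₀ᵀ (u₀'(t), v₀(t)) dt + ∫₀ᵀ â_Ω(u(t), v(t)) dt = ∫₀ᵀ (f(t), v₀(t)) dt` for all
`v = (v₀,v₁) ∈ 𝔽₀¹`. -/
def IsTwoScaleSolution {N : ℕ} (Ω : Set (RN N)) (T : ℝ) (a : Fin N → Fin N → RN N → ℝ)
    (f : Lp (Hm1N Ω) 2 (timeMeasure T)) (u : F01 Ω T) : Prop :=
  ∃ g : L2TVdual Ω T, HasTimeDeriv u.1 g ∧ HasZeroInitialValue u.1 ∧
    ∀ v : F01 Ω T,
      (∫ t in Ioo 0 T, g t (v.1 t))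
        + (∫ t in Ioo 0 T,
            aHat Ω a (u.1 t) (fun x => u.2 (x, t)) (v.1 t) (fun x => v.2 (x, t)))
      = ∫ t in Ioo 0 T, ∑ k, f t k ((v.1 t).incl k)

end

noncomputable section

open Filter Topology
open scoped Pointwise

/-! Test both problems with the difference w = (w₀, w₁) of two solutions and subtract. The
right-hand side cancels, leaving ∫₀ᵀ (w₀', w₀) dt + ∫₀ᵀ â_Ω(w, w) dt = 0. Both terms are
nonnegative, so the second one vanishes, and w = 0 follows from the definiteness of the form.

The time term is formally ½‖w₀(T)‖², because w₀(0) = 0. Only its sign matters, and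
`integral_weakDeriv_apply_self_nonneg` obtains it from backward differences. Let C be the continuous
representative in L²(Ω)^N, extended by zero. Integrating w₀'(t - r) over 0 < r < h gives C(t) - C(t
- h), by `eq_integral_of_weak_deriv`. The inequality (a - b, a) ≥ ½(|a|² - |b|²) then telescopes
after integration in t, and continuity of translations in L² brings the sign back to r = 0.

For the form, ellipticity gives the lower bound α ∑ₖ ‖∇w₀^k + ∇_y w₁^k‖². Gradients of periodic
functions have mean zero on Y (`IsH1loc.integral_cellY_grad`), so if the sum ∇w₀^k + ∇_y w₁^k
vanishes, each summand does (`eq_zero_of_fiberGrad_eq_zero`). Then w₀ = 0 by Poincaré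
(`H10.poincare`), and w₁ = 0 because a periodic function with zero mean and zero weak gradient
vanishes (`IsH1loc.ae_eq_zero_of_grad_eq_zero`).

A measure-theoretic point remains: w₀ is a V-valued function of t while w₁ is a function of (x, t).
The form at time t is therefore expressed through slices (`fiberAt`), and its integrability in t is
`integrable_lpPairing_slice`. -/

/-! ### Smooth cut-offs in time and primitives of weak derivatives -/

theorem contDiff_smoothTransition : ContDiff ℝ ∞ Real.smoothTransition :=
  Real.smoothTransition.contDiff

theorem deriv_smoothTransition_eq_zero {x : ℝ} (hx : x ∉ Icc (0 : ℝ) 1) :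
    deriv Real.smoothTransition x = 0 := by
  rw [mem_Icc, not_and_or, not_le, not_le] at hx
  rcases hx with hx | hx
  · have : Real.smoothTransition =ᶠ[𝓝 x] fun _ => 0 := by
      filter_upwards [Iio_mem_nhds hx] with y hy
      exact Real.smoothTransition.zero_of_nonpos (le_of_lt hy)
    rw [this.deriv_eq, deriv_const]
  · have : Real.smoothTransition =ᶠ[𝓝 x] fun _ => 1 := by
      filter_upwards [Ioi_mem_nhds hx] with y hy
      exact Real.smoothTransition.one_of_one_le (le_of_lt hy)
    rw [this.deriv_eq, deriv_const]

theorem continuous_deriv_smoothTransition : Continuous (deriv Real.smoothTransition) :=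
  contDiff_smoothTransition.continuous_deriv (by simp)

theorem hasCompactSupport_deriv_smoothTransition :
    HasCompactSupport (deriv Real.smoothTransition) :=
  HasCompactSupport.intro isCompact_Icc fun _ hx => deriv_smoothTransition_eq_zero hx

theorem integral_deriv_smoothTransition : ∫ x, deriv Real.smoothTransition x = 1 := by
  have h : ∫ x, deriv Real.smoothTransition x
      = ∫ x in Ioc (0 : ℝ) 1, deriv Real.smoothTransition x := by
    rw [← integral_Icc_eq_integral_Ioc]
    exact (setIntegral_eq_integral_of_forall_compl_eq_zero
      fun x hx => deriv_smoothTransition_eq_zero hx).symm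
  rw [h, ← intervalIntegral.integral_of_le zero_le_one,
    intervalIntegral.integral_deriv_eq_sub
      (fun x _ => (contDiff_smoothTransition.differentiable (by simp)).differentiableAt)
      (continuous_deriv_smoothTransition.intervalIntegrable _ _)]
  simp

/-- The rescaled derivatives of the smooth transition function concentrate at `s`. -/
theorem tendsto_integral_scaled_deriv_smoothTransition {k : ℝ → ℝ} (hk : Continuous k) {C : ℝ}
    (hC : ∀ x, |k x| ≤ C) (s : ℝ) :
    Tendsto (fun n : ℕ => ∫ t, ((n + 1 : ℝ) * deriv Real.smoothTransition ((n + 1) * (t - s))) * k t)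
      atTop (𝓝 (k s)) := by
  -- Substitute y = (n + 1)(t - s), so that n enters only through the argument of the bounded
  -- continuous function k.
  have h1 : ∀ n : ℕ, ∫ t, ((n + 1 : ℝ) * deriv Real.smoothTransition ((n + 1) * (t - s))) * k t
      = ∫ y, deriv Real.smoothTransition y * k (s + y / (n + 1)) := by
    intro n
    have hn : (0 : ℝ) < n + 1 := by positivity
    have e1 := integral_sub_right_eq_self (μ := volume) (fun t : ℝ =>
      ((n + 1 : ℝ) * deriv Real.smoothTransition ((n + 1) * t)) * k (s + t)) s
    have e2 := Measure.integral_comp_mul_left (fun y : ℝ =>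
      ((n + 1 : ℝ) * deriv Real.smoothTransition y) * k (s + y / (n + 1))) (n + 1 : ℝ)
    have e3 : ∀ t : ℝ, s + (n + 1) * t / (n + 1 : ℝ) = s + t := fun t => by field_simp
    simp only [add_sub_cancel] at e1
    simp only [e3] at e2
    rw [e1, e2]
    simp only [mul_assoc]
    rw [integral_const_mul, abs_of_pos (by positivity), smul_eq_mul, ← mul_assoc,
      inv_mul_cancel₀ hn.ne', one_mul]
  simp only [h1]
  have h2 : k s = ∫ y, deriv Real.smoothTransition y * k s := by
    rw [integral_mul_const, integral_deriv_smoothTransition, one_mul]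
  rw [h2]
  have hint : Integrable (deriv Real.smoothTransition) :=
    continuous_deriv_smoothTransition.integrable_of_hasCompactSupport
      hasCompactSupport_deriv_smoothTransition
  refine tendsto_integral_of_dominated_convergence
    (fun y => ‖deriv Real.smoothTransition y‖ * C) (fun n => ?_) (hint.norm.mul_const C)
    (fun n => ?_) ?_
  · exact (continuous_deriv_smoothTransition.mul (hk.comp (by fun_prop))).aestronglyMeasurable
  · refine Eventually.of_forall fun y => ?_
    rw [norm_mul]
    exact mul_le_mul_of_nonneg_left (hC _) (norm_nonneg _)
  · refine Eventually.of_forall fun y => ?_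
    refine Tendsto.const_mul _ ?_
    have h3 : Tendsto (fun n : ℕ => s + y / ((n : ℝ) + 1)) atTop (𝓝 (s + 0)) :=
      tendsto_const_nhds.add
        (tendsto_const_nhds.div_atTop (tendsto_natCast_atTop_atTop.atTop_add tendsto_const_nhds))
    rw [add_zero] at h3
    exact (hk.tendsto s).comp h3

/-- At t = s the argument is 0, where the transition function still vanishes. The limit is thus the
indicator of the open half-line, and a difference of two such limits is the indicator of a half-open
interval at every point. -/
theorem tendsto_smoothTransition_scaled (t s : ℝ) :
    Tendsto (fun n : ℕ => Real.smoothTransition ((n + 1) * (t - s))) atTop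
      (𝓝 ((Ioi s).indicator (fun _ => 1) t)) := by
  by_cases h : s < t
  · have h1 : Tendsto (fun n : ℕ => ((n : ℝ) + 1) * (t - s)) atTop atTop :=
      (tendsto_natCast_atTop_atTop.atTop_add tendsto_const_nhds).atTop_mul_const (sub_pos.2 h)
    rw [indicator_of_mem (mem_Ioi.2 h)]
    refine tendsto_const_nhds.congr' ?_
    filter_upwards [h1.eventually_ge_atTop 1] with n hn
    exact (Real.smoothTransition.one_of_one_le hn).symm
  · rw [indicator_of_notMem (by simpa using h)]
    refine tendsto_const_nhds.congr fun n => ?_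
    refine (Real.smoothTransition.zero_of_nonpos ?_).symm
    exact mul_nonpos_of_nonneg_of_nonpos (by positivity) (by linarith)

/-- The smooth approximation of the indicator of `(s₁, s₂]`. -/
def smoothPlateau (s₁ s₂ : ℝ) (n : ℕ) (t : ℝ) : ℝ :=
  Real.smoothTransition ((n + 1) * (t - s₁)) - Real.smoothTransition ((n + 1) * (t - s₂))

theorem hasDerivAt_smoothTransition_scaled (s : ℝ) (n : ℕ) (t : ℝ) :
    HasDerivAt (fun t : ℝ => Real.smoothTransition ((n + 1) * (t - s)))
      ((n + 1 : ℝ) * deriv Real.smoothTransition ((n + 1) * (t - s))) t := by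
  have h1 : HasDerivAt (fun t : ℝ => ((n : ℝ) + 1) * (t - s)) ((n : ℝ) + 1) t := by
    simpa using ((hasDerivAt_id t).sub_const s).const_mul ((n : ℝ) + 1)
  have h2 := (contDiff_smoothTransition.differentiable (by simp)
    (((n : ℝ) + 1) * (t - s))).hasDerivAt
  rw [mul_comm]
  exact h2.comp t h1

theorem deriv_smoothPlateau (s₁ s₂ : ℝ) (n : ℕ) (t : ℝ) :
    deriv (smoothPlateau s₁ s₂ n) t =
      (n + 1 : ℝ) * deriv Real.smoothTransition ((n + 1) * (t - s₁))
      - (n + 1 : ℝ) * deriv Real.smoothTransition ((n + 1) * (t - s₂)) :=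
  ((hasDerivAt_smoothTransition_scaled s₁ n t).sub
    (hasDerivAt_smoothTransition_scaled s₂ n t)).deriv

theorem smoothPlateau_eq_zero {s₁ s₂ : ℝ} (h : s₁ ≤ s₂) {n : ℕ} {t : ℝ}
    (ht : t ∉ Icc s₁ (s₂ + 1 / (n + 1))) : smoothPlateau s₁ s₂ n t = 0 := by
  have hn : (0 : ℝ) < n + 1 := by positivity
  rw [mem_Icc, not_and_or, not_le, not_le] at ht
  unfold smoothPlateau
  rcases ht with ht | ht
  · rw [Real.smoothTransition.zero_of_nonpos, Real.smoothTransition.zero_of_nonpos, sub_zero]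
    · exact mul_nonpos_of_nonneg_of_nonpos hn.le (by linarith)
    · exact mul_nonpos_of_nonneg_of_nonpos hn.le (by linarith)
  · have h2 : 1 ≤ ((n : ℝ) + 1) * (t - s₂) := by
      have : 1 / ((n : ℝ) + 1) ≤ t - s₂ := by linarith
      rw [div_le_iff₀ hn] at this
      linarith
    have h3 : 1 ≤ ((n : ℝ) + 1) * (t - s₁) :=
      h2.trans (mul_le_mul_of_nonneg_left (by linarith) hn.le)
    rw [Real.smoothTransition.one_of_one_le h2, Real.smoothTransition.one_of_one_le h3, sub_self]

theorem isTestFun_smoothPlateau {T s₁ s₂ : ℝ} (h0 : 0 < s₁) (h : s₁ ≤ s₂) {n : ℕ}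
    (hn : s₂ + 1 / (n + 1) < T) : IsTestFun (Ioo 0 T) (smoothPlateau s₁ s₂ n) := by
  refine ⟨?_, HasCompactSupport.intro isCompact_Icc fun t ht => smoothPlateau_eq_zero h ht, ?_⟩
  · unfold smoothPlateau
    exact (contDiff_smoothTransition.comp (by fun_prop)).sub
      (contDiff_smoothTransition.comp (by fun_prop))
  · refine (closure_minimal (t := Icc s₁ (s₂ + 1 / (n + 1))) ?_ isClosed_Icc).trans ?_
    · intro t ht
      by_contra h'
      exact ht (smoothPlateau_eq_zero h h')
    · exact fun t ht => ⟨h0.trans_le ht.1, ht.2.trans_lt hn⟩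

/-- A continuous function on `[0,T]` vanishing at `0` is the primitive of its integrable
distributional derivative. -/
theorem eq_integral_of_weak_deriv {T : ℝ} (hT : 0 < T) {k q : ℝ → ℝ}
    (hk : ContinuousOn k (Icc 0 T)) (hk0 : k 0 = 0) (hq : IntegrableOn q (Ioo 0 T))
    (hw : ∀ φ : ℝ → ℝ, IsTestFun (Ioo 0 T) φ →
      ∫ t in Ioo 0 T, deriv φ t * k t = - ∫ t in Ioo 0 T, φ t * q t) {t : ℝ}
    (ht : t ∈ Icc 0 T) : k t = ∫ s in (0)..t, q s := by
  -- Extension by the endpoint values is continuous and bounded on all of ℝ, as the concentration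
  -- lemma requires.
  set K : ℝ → ℝ := IccExtend hT.le ((Icc 0 T).domRestrict k) with hKdef
  have hKc : Continuous K := (continuousOn_iff_continuous_domRestrict.1 hk).Icc_extend'
  have hKk : ∀ t ∈ Icc 0 T, K t = k t := fun t ht => IccExtend_of_mem hT.le _ ht
  obtain ⟨C, hC⟩ : ∃ C, ∀ x, |K x| ≤ C := by
    obtain ⟨C, hC⟩ := isCompact_Icc.exists_bound_of_continuousOn hk
    exact ⟨C, fun x => hC _ (projIcc 0 T hT.le x).2⟩
  have hqI : IntervalIntegrable q volume 0 T :=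
    (intervalIntegrable_iff_integrableOn_Ioo_of_le hT.le).2 hq
  -- Test with the smoothed indicator of (s₁, s₂]: its derivative concentrates at s₁ with sign + and
  -- at s₂ with sign -, while the function itself converges boundedly to the indicator.
  have key : ∀ s₁ s₂ : ℝ, 0 < s₁ → s₁ ≤ s₂ → s₂ < T → K s₁ - K s₂ = - ∫ s in s₁..s₂, q s := by
    intro s₁ s₂ h1 h12 h2
    have hL := (tendsto_integral_scaled_deriv_smoothTransition hKc hC s₁).sub
      (tendsto_integral_scaled_deriv_smoothTransition hKc hC s₂)
    have hint : ∀ (n : ℕ) (s : ℝ), Integrable fun t : ℝ =>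
        ((n + 1 : ℝ) * deriv Real.smoothTransition ((n + 1) * (t - s))) * K t := by
      intro n s
      have hcs : HasCompactSupport fun t : ℝ => deriv Real.smoothTransition ((n + 1) * (t - s)) := by
        have hn : (0 : ℝ) < n + 1 := by positivity
        refine HasCompactSupport.intro (K := Icc s (s + 1 / (n + 1))) isCompact_Icc fun x hx => ?_
        refine deriv_smoothTransition_eq_zero fun h => hx ⟨?_, ?_⟩
        · have := nonneg_of_mul_nonneg_right h.1 hn
          linarith
        · have := h.2
          rw [← le_div_iff₀' hn] at this
          linarith
      refine Continuous.integrable_of_hasCompactSupport ?_ (hcs.mul_left.mul_right)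
      exact (continuous_const.mul (continuous_deriv_smoothTransition.comp (by fun_prop))).mul hKc
    have hR : Tendsto (fun n : ℕ => - ∫ t in Ioo 0 T, smoothPlateau s₁ s₂ n t * q t) atTop
        (𝓝 (- ∫ t in Ioo 0 T, (Ioc s₁ s₂).indicator q t)) := by
      refine Tendsto.neg (tendsto_integral_of_dominated_convergence (fun t => ‖q t‖)
        (fun n => ?_) hq.norm (fun n => ?_) ?_)
      · refine AEStronglyMeasurable.mul (Continuous.aestronglyMeasurable ?_) hq.aestronglyMeasurable
        exact (Real.smoothTransition.continuous.comp (by fun_prop)).sub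
          (Real.smoothTransition.continuous.comp (by fun_prop))
      · refine Eventually.of_forall fun t => ?_
        rw [norm_mul]
        refine mul_le_of_le_one_left (norm_nonneg _) ?_
        rw [Real.norm_eq_abs, abs_le]
        unfold smoothPlateau
        have a1 := Real.smoothTransition.nonneg ((n + 1) * (t - s₁))
        have a2 := Real.smoothTransition.nonneg ((n + 1) * (t - s₂))
        have a3 := Real.smoothTransition.le_one ((n + 1) * (t - s₁))
        have a4 := Real.smoothTransition.le_one ((n + 1) * (t - s₂))
        constructor <;> linarith
      · refine Eventually.of_forall fun t => ?_
        have := ((tendsto_smoothTransition_scaled t s₁).sub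
          (tendsto_smoothTransition_scaled t s₂)).mul_const (q t)
        have e : ((Ioi s₁).indicator (fun _ => (1 : ℝ)) t - (Ioi s₂).indicator (fun _ => 1) t) * q t
            = (Ioc s₁ s₂).indicator q t := by
          by_cases a1 : s₁ < t <;> by_cases a2 : s₂ < t
          · simp [indicator, a1, a2]
          · simp [indicator, a1, a2, not_lt.1 a2]
          · exact absurd (h12.trans_lt a2) a1
          · simp [indicator, a1, a2]
        rw [← e]
        exact this
    -- The plateau reaches 1/(n + 1) beyond s₂, so it is an admissible test function only for large
    -- n.
    have hev : ∀ᶠ n : ℕ in atTop, s₂ + 1 / ((n : ℝ) + 1) < T := by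
      have : Tendsto (fun n : ℕ => s₂ + 1 / ((n : ℝ) + 1)) atTop (𝓝 (s₂ + 0)) :=
        tendsto_const_nhds.add tendsto_one_div_add_atTop_nhds_zero_nat
      rw [add_zero] at this
      exact this.eventually_lt_const h2
    have heq := tendsto_nhds_unique_of_eventuallyEq hL hR (by
      filter_upwards [hev] with n hn
      have htest := isTestFun_smoothPlateau h1 h12 hn
      rw [← hw _ htest, ← integral_sub (hint n s₁) (hint n s₂)]
      have hz : ∀ t ∉ Ioo 0 T, deriv (smoothPlateau s₁ s₂ n) t * K t = 0 := by
        intro t ht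
        rw [image_eq_zero_of_notMem_tsupport (f := deriv (smoothPlateau s₁ s₂ n))
          (fun h => ht (htest.2.2 (tsupport_deriv_subset (𝕜 := ℝ) (f := smoothPlateau s₁ s₂ n) h))), zero_mul]
      rw [setIntegral_congr_fun measurableSet_Ioo
        (g := fun t => deriv (smoothPlateau s₁ s₂ n) t * K t) fun t ht => by
          simp only [hKk t (Ioo_subset_Icc_self ht)],
        setIntegral_eq_integral_of_forall_compl_eq_zero hz]
      refine integral_congr_ae (Eventually.of_forall fun t => ?_)
      simp only [deriv_smoothPlateau, sub_mul])
    rw [heq, intervalIntegral.integral_of_le h12, setIntegral_indicator measurableSet_Ioc,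
      inter_eq_self_of_subset_right (show Ioc s₁ s₂ ⊆ Ioo 0 T from
        fun t ht => ⟨h1.trans ht.1, ht.2.trans_lt h2⟩)]
  -- F is constant on the open interval by `key`, hence on [0, T] by continuity, and F 0 = 0.
  set F : ℝ → ℝ := fun t => k t - ∫ s in (0)..t, q s with hF
  have hFc : ContinuousOn F (Icc 0 T) := by
    refine hk.sub ?_
    have := intervalIntegral.continuousOn_primitive_interval (a := 0) (b := T) (f := q)
      (μ := volume) (by rw [uIcc_of_le hT.le, integrableOn_Icc_iff_integrableOn_Ioo]; exact hq)
    rwa [uIcc_of_le hT.le] at this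
  have hm : T / 2 ∈ Ioo 0 T := ⟨by linarith, by linarith⟩
  have hII : ∀ a ∈ Ioo 0 T, ∀ b ∈ Ioo 0 T, IntervalIntegrable q volume a b := fun a ha b hb =>
    hqI.mono_set (by
      rw [uIcc_of_le hT.le]
      exact uIcc_subset_Icc (Ioo_subset_Icc_self ha) (Ioo_subset_Icc_self hb))
  have hII0 : ∀ a ∈ Ioo 0 T, IntervalIntegrable q volume 0 a := fun a ha =>
    hqI.mono_set (by
      rw [uIcc_of_le hT.le]
      exact uIcc_subset_Icc ⟨le_rfl, hT.le⟩ (Ioo_subset_Icc_self ha))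
  have hle : ∀ s ∈ Ioo 0 T, ∀ r ∈ Ioo 0 T, s ≤ r → F s = F r := by
    intro s hs r hr h
    have h1 := key s r hs.1 h hr.2
    rw [hKk s (Ioo_subset_Icc_self hs), hKk r (Ioo_subset_Icc_self hr)] at h1
    have h2 := intervalIntegral.integral_add_adjacent_intervals (hII0 s hs) (hII s hs r hr)
    simp only [hF]
    linarith
  have hconst : EqOn F (fun _ => F (T / 2)) (Ioo 0 T) := fun s hs =>
    (le_total s (T / 2)).elim (fun h => hle s hs _ hm h) fun h => (hle _ hm s hs h).symm
  have hconst' : EqOn F (fun _ => F (T / 2)) (Icc 0 T) :=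
    hconst.of_subset_closure hFc continuousOn_const Ioo_subset_Icc_self
      (by rw [closure_Ioo hT.ne])
  have e0 : F 0 = 0 := by simp [hF, hk0]
  have : F t = F 0 := (hconst' ht).trans (hconst' ⟨le_rfl, hT.le⟩).symm
  rw [e0] at this
  exact sub_eq_zero.1 this

/-! ### The energy inequality by backward differences -/

/-- The translation correlation `r ↦ ∫ g(t - r)(u(t)) dt` of square integrable functions is
continuous. -/
theorem continuous_integral_translate_dual {V : Type*} [NormedAddCommGroup V] [NormedSpace ℝ V]
    {g : ℝ → StrongDual ℝ V} {u : ℝ → V} (hg : MemLp g 2) (hu : MemLp u 2) :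
    Continuous fun r : ℝ => ∫ t, g (t - r) (u t) := by
  have hmp : ∀ r : ℝ, MeasurePreserving (fun t : ℝ => t - r) := fun r =>
    measurePreserving_sub_right volume r
  let S : C(ℝ, C(ℝ, ℝ)) :=
    ContinuousMap.curry ⟨fun p : ℝ × ℝ => p.2 - p.1, by fun_prop⟩
  have hc : Continuous fun r : ℝ =>
      Lp.compMeasurePreserving (S r) (hmp r) (hg.toLp g) :=
    -- This is the continuity of translations in L²; only g is translated, and u stays fixed in the
    -- duality pairing.
    (continuous_const (y := hg.toLp g)).compMeasurePreservingLp S.continuous hmp (by norm_num)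
  let B : StrongDual ℝ V →L[ℝ] V →L[ℝ] ℝ := ContinuousLinearMap.id ℝ _
  have hP : Continuous fun r : ℝ => B.lpPairing volume 2 2
      (Lp.compMeasurePreserving (S r) (hmp r) (hg.toLp g)) (hu.toLp u) :=
    ((B.lpPairing volume 2 2).continuous.comp hc).clm_apply continuous_const
  refine hP.congr fun r => ?_
  rw [ContinuousLinearMap.lpPairing_eq_integral]
  refine integral_congr_ae ?_
  have h1 := Lp.coeFn_compMeasurePreserving (hg.toLp g) (hmp r)
  have h2 := (hmp r).quasiMeasurePreserving.ae_eq_comp hg.coeFn_toLp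
  filter_upwards [h1, h2, hu.coeFn_toLp] with t a1 a2 a3
  have a4 : (Lp.compMeasurePreserving (S r) (hmp r) (hg.toLp g)) t = g (t - r) := a1.trans a2
  rw [a4, a3]
  rfl

/-- The integrand of the averaged translation correlation is integrable. -/
theorem integrable_translate_dual {V : Type*} [NormedAddCommGroup V] [NormedSpace ℝ V]
    {g : ℝ → StrongDual ℝ V} {u : ℝ → V} (hg : MemLp g 2) (hu : MemLp u 2)
    (s : Set ℝ) [IsFiniteMeasure (volume.restrict s)] :
    Integrable (fun p : ℝ × ℝ => g (p.2 - p.1) (u p.2)) ((volume.restrict s).prod volume) := by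
  -- The shear preserves the product measure, so both measurability and integrability of g(t - r) in
  -- (r, t) reduce to those of g(t).
  have hmp : MeasurePreserving (fun p : ℝ × ℝ => (p.1, p.2 - p.1))
      ((volume.restrict s).prod volume) ((volume.restrict s).prod volume) :=
    (MeasurePreserving.id _).skew_product (g := fun r t => t - r) (by fun_prop)
      (Eventually.of_forall fun r => (measurePreserving_sub_right volume r).map_eq)
  have hgm : AEStronglyMeasurable (fun p : ℝ × ℝ => g (p.2 - p.1))
      ((volume.restrict s).prod volume) :=
    (hg.1.comp_snd (μ := volume.restrict s)).comp_quasiMeasurePreserving hmp.quasiMeasurePreserving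
  have hum : AEStronglyMeasurable (fun p : ℝ × ℝ => u p.2) ((volume.restrict s).prod volume) :=
    hu.1.comp_snd
  have hg2 : Integrable (fun p : ℝ × ℝ => ‖g (p.2 - p.1)‖ ^ 2) ((volume.restrict s).prod volume) :=
    hmp.integrable_comp_of_integrable (g := fun p : ℝ × ℝ => ‖g p.2‖ ^ 2)
      ((hg.integrable_norm_pow (by norm_num)).comp_snd _)
  have hu2 : Integrable (fun p : ℝ × ℝ => ‖u p.2‖ ^ 2) ((volume.restrict s).prod volume) :=
    (hu.integrable_norm_pow (by norm_num)).comp_snd _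
  refine (hg2.add hu2).mono' ?_ (Eventually.of_forall fun p => ?_)
  · exact (ContinuousLinearMap.id ℝ (StrongDual ℝ V)).aestronglyMeasurable_comp₂ hgm hum
  · refine (ContinuousLinearMap.le_opNorm _ _).trans ?_
    simp only [Pi.add_apply]
    nlinarith [sq_nonneg (‖g (p.2 - p.1)‖ - ‖u p.2‖), sq_nonneg (‖g (p.2 - p.1)‖ + ‖u p.2‖)]

/-- If the primitive of `g` is represented by a function `C` with values in the pivot space, and
`C` is the image of `u`, then the averaged translation correlation of `g` and `u` is
nonnegative. -/
theorem integral_integral_translate_dual_nonneg {V H : Type*} [NormedAddCommGroup V]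
    [NormedSpace ℝ V] [NormedAddCommGroup H] [InnerProductSpace ℝ H] (j : V → H)
    {T : ℝ} (hT : 0 < T) {u : ℝ → V} {g : ℝ → StrongDual ℝ V} (hu : MemLp u 2) (hg : MemLp g 2)
    (hg1 : Integrable g) (hu0 : ∀ t ∉ Ioo 0 T, u t = 0) {C : ℝ → H}
    (hC2 : Integrable fun t => ‖C t‖ ^ 2) (hC0 : ∀ t < 0, C t = 0)
    (hCu : ∀ᵐ t, t ∈ Ioo 0 T → C t = j (u t))
    (hprim : ∀ v : V, ∀ t ≤ T, ∫ s in (0)..t, g s v = ⟪C t, j v⟫) {h : ℝ} (hh : 0 < h) :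
    0 ≤ ∫ r in (0)..h, ∫ t, g (t - r) (u t) := by
  have hFI := integrable_translate_dual hg hu (Ioc 0 h)
  have hgv : ∀ v : V, Integrable fun s => g s v := fun v =>
    (ContinuousLinearMap.apply ℝ ℝ v).integrable_comp hg1
  -- Here t - h may be negative; `hprim` covers that case because C vanishes there.
  have e2 : ∀ t < T, ∀ v : V, ∫ r in (0)..h, g (t - r) v = ⟪C t - C (t - h), j v⟫ := by
    intro t ht v
    rw [intervalIntegral.integral_comp_sub_left (fun s => g s v) t, sub_zero, inner_sub_left,
      ← hprim v t ht.le, ← hprim v (t - h) (by linarith),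
      intervalIntegral.integral_interval_sub_left] <;>
    exact (hgv v).intervalIntegrable
  have hCI : ∀ a b : ℝ, IntervalIntegrable (fun t => ‖C t‖ ^ 2) volume a b := fun a b =>
    hC2.intervalIntegrable
  rw [intervalIntegral.integral_of_le hh.le, integral_integral_swap hFI]
  have e1 : ∫ t, ∫ r in Ioc 0 h, g (t - r) (u t)
      = ∫ t in Ioo 0 T, ∫ r in Ioc 0 h, g (t - r) (u t) := by
    refine (setIntegral_eq_integral_of_forall_compl_eq_zero fun t ht => ?_).symm
    simp [hu0 t ht]
  rw [e1]
  -- Telescoping: since C = 0 on negative times, shifting by h removes from ∫₀ᵀ ‖C‖² exactly the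
  -- piece over (T - h, T), which is nonnegative.
  calc (0 : ℝ) ≤ 1 / 2 * ∫ t in (T - h)..T, ‖C t‖ ^ 2 :=
        mul_nonneg (by norm_num) (intervalIntegral.integral_nonneg (by linarith)
          fun t _ => by positivity)
    _ = 1 / 2 * ((∫ t in (0)..T, ‖C t‖ ^ 2) - ∫ t in (0)..T, ‖C (t - h)‖ ^ 2) := by
        rw [intervalIntegral.integral_comp_sub_right (fun t => ‖C t‖ ^ 2) h, zero_sub]
        have z : ∫ t in (-h)..0, ‖C t‖ ^ 2 = 0 := by
          rw [intervalIntegral.integral_of_le (by linarith), integral_Ioc_eq_integral_Ioo]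
          refine (setIntegral_congr_fun measurableSet_Ioo (g := fun _ => (0 : ℝ))
            fun t ht => ?_).trans (by simp)
          simp [hC0 t ht.2]
        have a1 := intervalIntegral.integral_add_adjacent_intervals (hCI (-h) 0) (hCI 0 (T - h))
        have a2 := intervalIntegral.integral_add_adjacent_intervals (hCI 0 (T - h)) (hCI (T - h) T)
        congr 1
        linarith
    _ = ∫ t in Ioo 0 T, 1 / 2 * (‖C t‖ ^ 2 - ‖C (t - h)‖ ^ 2) := by
        rw [integral_const_mul, integral_sub hC2.integrableOn
          (hC2.comp_sub_right h).integrableOn, intervalIntegral.integral_of_le hT.le,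
          intervalIntegral.integral_of_le hT.le, integral_Ioc_eq_integral_Ioo,
          integral_Ioc_eq_integral_Ioo]
    _ ≤ ∫ t in Ioo 0 T, ∫ r in Ioc 0 h, g (t - r) (u t) := by
        refine integral_mono_ae
          ((hC2.sub (hC2.comp_sub_right h)).const_mul (1 / 2)).integrableOn
          hFI.integral_prod_right.integrableOn ?_
        filter_upwards [ae_restrict_of_ae (s := Ioo 0 T) hCu,
          ae_restrict_mem measurableSet_Ioo] with t h1 h2
        rw [← intervalIntegral.integral_of_le hh.le, e2 t h2.2, ← h1 h2, inner_sub_left,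
          real_inner_self_eq_norm_sq]
        -- Cauchy–Schwarz and Young give ‖a‖² - ⟪b, a⟫ ≥ ½(‖a‖² - ‖b‖²).
        have := real_inner_le_norm (C (t - h)) (C t)
        nlinarith [sq_nonneg (‖C t‖ - ‖C (t - h)‖)]

/-- If P 0 < 0, continuity keeps P negative near 0 and short integrals would be negative. This
removes the averaging over translations. -/
theorem nonneg_of_integral_nonneg {P : ℝ → ℝ} (hP : Continuous P)
    (h : ∀ δ : ℝ, 0 < δ → 0 ≤ ∫ r in (0)..δ, P r) : 0 ≤ P 0 := by
  by_contra hneg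
  rw [not_le] at hneg
  obtain ⟨δ, hδ, hball⟩ := Metric.eventually_nhds_iff.1 (hP.continuousAt.eventually_lt_const hneg)
  have h1 := h (δ / 2) (by linarith)
  have h2 : 0 < ∫ r in (0)..(δ / 2), - P r :=
    intervalIntegral.intervalIntegral_pos_of_pos_on (hP.neg.intervalIntegrable _ _)
      (fun x hx => neg_pos.2 (hball (by
        rw [Real.dist_eq, sub_zero, abs_of_pos hx.1]; linarith [hx.2]))) (by linarith)
  rw [intervalIntegral.integral_neg] at h2
  linarith

theorem memLp_indicator_timeMeasure {E : Type*} [NormedAddCommGroup E] {T : ℝ} {f : ℝ → E}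
    (hf : MemLp f 2 (timeMeasure T)) : MemLp ((Ioo 0 T).indicator f) 2 volume :=
  (memLp_indicator_iff_restrict measurableSet_Ioo).2 hf

theorem integrable_indicator_timeMeasure {E : Type*} [NormedAddCommGroup E] {T : ℝ} {f : ℝ → E}
    (hf : Integrable f (timeMeasure T)) : Integrable ((Ioo 0 T).indicator f) volume :=
  (integrable_indicator_iff measurableSet_Ioo).2 hf

/-- Energy inequality: if `g` is the weak time derivative of `u` with respect to the pivot space
`H`, and the `H`-continuous representative `c` of `u` vanishes at `0`, then `∫₀ᵀ (g, u) ≥ 0`. -/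
theorem integral_weakDeriv_apply_self_nonneg {V H : Type*} [NormedAddCommGroup V]
    [NormedSpace ℝ V] [NormedAddCommGroup H] [InnerProductSpace ℝ H] (j : V → H)
    {T : ℝ} (hT : 0 < T) {u : ℝ → V} {g : ℝ → StrongDual ℝ V}
    (hu : MemLp u 2 (timeMeasure T)) (hg : MemLp g 2 (timeMeasure T))
    (hw : ∀ φ : ℝ → ℝ, IsTestFun (Ioo 0 T) φ → ∀ v : V,
      ∫ t in Ioo 0 T, deriv φ t * ⟪j (u t), j v⟫ = - ∫ t in Ioo 0 T, φ t * g t v)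
    {c : ℝ → H} (hc : ContinuousOn c (Icc 0 T)) (hc0 : c 0 = 0)
    (hcu : ∀ᵐ t ∂(timeMeasure T), c t = j (u t)) :
    0 ≤ ∫ t in Ioo 0 T, g t (u t) := by
  have hgi : Integrable g (timeMeasure T) := hg.integrable one_le_two
  set G : ℝ → StrongDual ℝ V := (Ioo 0 T).indicator g with hG
  set U : ℝ → V := (Ioo 0 T).indicator u with hU
  have hGg : ∀ t ∈ Ioo 0 T, G t = g t := fun t ht => indicator_of_mem ht g
  have hG2 : MemLp G 2 volume := memLp_indicator_timeMeasure hg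
  have hU2 : MemLp U 2 volume := memLp_indicator_timeMeasure hu
  have hGi : Integrable G := integrable_indicator_timeMeasure hgi
  -- Because c 0 = 0, extension by zero to t < 0 keeps C the primitive of G. Beyond T it does not,
  -- hence the restriction t ≤ T in `hprim`.
  set C : ℝ → H := (Icc 0 T).indicator c with hC
  have hCc : ∀ t ∈ Icc 0 T, C t = c t := fun t ht => indicator_of_mem ht c
  have hC2 : Integrable fun t => ‖C t‖ ^ 2 := by
    have h1 : IntegrableOn (fun t => ‖c t‖ ^ 2) (Icc 0 T) :=
      (hc.norm.pow 2).integrableOn_compact isCompact_Icc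
    refine ((integrable_indicator_iff measurableSet_Icc).2 h1).congr
      (Eventually.of_forall fun t => ?_)
    by_cases ht : t ∈ Icc 0 T
    · simp only [hC, indicator_of_mem ht]
    · simp only [hC, indicator_of_notMem ht]; simp
  have hC0 : ∀ t < 0, C t = 0 := fun t ht => indicator_of_notMem (fun h => ht.not_ge h.1) c
  have hprim : ∀ v : V, ∀ t ≤ T, ∫ s in (0)..t, G s v = ⟪C t, j v⟫ := by
    intro v t htT
    by_cases ht : 0 ≤ t
    · rw [hCc t ⟨ht, htT⟩]
      refine (eq_integral_of_weak_deriv hT (k := fun t => ⟪c t, j v⟫) (q := fun t => G t v)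
        (hc.inner continuousOn_const) (by simp [hc0])
        ((ContinuousLinearMap.apply ℝ ℝ v).integrable_comp hGi).integrableOn
        (fun φ hφ => ?_) ⟨ht, htT⟩).symm
      rw [setIntegral_congr_fun (f := fun t => φ t * G t v) (g := fun t => φ t * g t v)
        measurableSet_Ioo fun t ht => by simp only [hGg t ht], ← hw φ hφ v]
      refine integral_congr_ae ?_
      filter_upwards [hcu] with t ht
      rw [ht]
    · rw [not_le] at ht
      rw [hC0 t ht, inner_zero_left, intervalIntegral.integral_congr (g := fun _ => (0 : ℝ)),
        intervalIntegral.integral_zero]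
      intro s hs
      rw [uIcc_of_ge ht.le] at hs
      have : G s = 0 := indicator_of_notMem (fun h => absurd h.1 (not_lt.2 hs.2)) g
      simp [this]
  have hP0 : ∫ t, G (t - 0) (U t) = ∫ t in Ioo 0 T, g t (u t) := by
    rw [← integral_indicator measurableSet_Ioo]
    refine integral_congr_ae (Eventually.of_forall fun t => ?_)
    by_cases ht : t ∈ Ioo 0 T <;> simp [hG, hU, ht]
  rw [← hP0]
  refine nonneg_of_integral_nonneg (continuous_integral_translate_dual hG2 hU2) fun h hh =>
    integral_integral_translate_dual_nonneg j hT hU2 hG2 hGi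
      (fun t ht => indicator_of_notMem ht u) hC2 hC0 ?_ hprim hh
  filter_upwards [(ae_restrict_iff' measurableSet_Ioo).1 hcu] with t h1 h2
  rw [hCc t (Ioo_subset_Icc_self h2), h1 h2]
  simp only [hU, indicator_of_mem h2]

/-! ### The Poincaré inequality on H₀¹(Ω) -/

theorem norm_sq_eq_integral_L2 {α E : Type*} [MeasurableSpace α] {μ : Measure α}
    [NormedAddCommGroup E] (f : Lp E 2 μ) : ‖f‖ ^ 2 = ∫ x, ‖f x‖ ^ 2 ∂μ := by
  have h0 : 0 ≤ ∫ x, ‖f x‖ ^ 2 ∂μ := integral_nonneg fun x => by positivity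
  rw [Lp.norm_def, toReal_eLpNorm (Lp.aestronglyMeasurable f),
    lpNorm_eq_integral_norm_rpow_toReal two_ne_zero ENNReal.ofNat_ne_top
      (Lp.aestronglyMeasurable f)]
  simp only [ENNReal.toReal_ofNat, Real.rpow_two]
  rw [← Real.rpow_natCast, ← Real.rpow_mul h0]
  norm_num

theorem IsTestFun.mono {N : ℕ} {U : Set (RN N)} {φ : RN N → ℝ} (h : IsTestFun U φ) :
    IsTestFun univ φ := ⟨h.1, h.2.1, subset_univ _⟩

theorem IsTestFun.differentiable {F : Type*} [NormedAddCommGroup F] [NormedSpace ℝ F] {U : Set F}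
    {φ : F → ℝ} (h : IsTestFun U φ) : Differentiable ℝ φ := h.1.differentiable (by simp)

theorem IsTestFun.hasGradientAt {N : ℕ} {U : Set (RN N)} {φ : RN N → ℝ} (h : IsTestFun U φ)
    (x : RN N) : HasGradientAt φ (gradient φ x) x := (h.differentiable x).hasGradientAt

theorem fderiv_single_eq_gradient {N : ℕ} {φ : RN N → ℝ} {x : RN N} (h : DifferentiableAt ℝ φ x)
    (i : Fin N) : fderiv ℝ φ x (EuclideanSpace.single i 1) = gradient φ x i := by
  rw [h.hasGradientAt.hasFDerivAt.fderiv, InnerProductSpace.toDual_apply_apply,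
    EuclideanSpace.inner_single_right]
  simp

/-- The Poincaré inequality for test functions supported in a ball. -/
theorem IsTestFun.poincare {N : ℕ} (hN : 0 < N) {Ω : Set (RN N)} {R : ℝ}
    (hR : ∀ x ∈ Ω, ‖x‖ ≤ R) {φ : RN N → ℝ} (hφ : IsTestFun Ω φ) :
    ∫ x, ‖φ x‖ ^ 2 ≤ 4 * R ^ 2 * ∫ x, ‖gradient φ x‖ ^ 2 := by
  let i : Fin N := ⟨0, hN⟩
  let e : RN N := EuclideanSpace.single i 1
  let l : RN N →L[ℝ] ℝ := EuclideanSpace.proj i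
  have hle : ∀ x, fderiv ℝ l x e = 1 := fun x => by
    rw [l.fderiv]; simp [l, e]
  have hφc := hφ.1.continuous
  have hgc := hφ.mono.continuous_gradient
  have hgs := hφ.mono.hasCompactSupport_gradient
  have hd2 : ∀ x, fderiv ℝ (fun x => φ x ^ 2) x e = 2 * φ x * gradient φ x i := by
    intro x
    rw [← fderiv_single_eq_gradient (hφ.differentiable x)]
    have := ((hφ.differentiable x).hasFDerivAt.pow 2).fderiv
    simp [this, e]
  have h2s : HasCompactSupport fun x => φ x ^ 2 := hφ.2.1.comp_left (g := fun t : ℝ => t ^ 2) (by simp)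
  have hgs' : HasCompactSupport fun x => gradient φ x i :=
    hgs.comp_left (g := fun z : RN N => z i) rfl
  have hgc' : Continuous fun x => gradient φ x i := (EuclideanSpace.proj i).continuous.comp hgc
  -- Since ∂ᵢxᵢ = 1, integration by parts gives ∫ φ² = -∫ 2 φ ∂ᵢφ xᵢ.
  have ibp := integral_mul_fderiv_eq_neg_fderiv_mul_of_integrable (μ := volume)
    (f := fun x => φ x ^ 2) (g := l) (v := e)
    (by
      simp only [hd2]
      exact Continuous.integrable_of_hasCompactSupport (by fun_prop) (hgs'.mul_left.mul_right))
    (by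
      simp only [hle, mul_one]
      exact Continuous.integrable_of_hasCompactSupport (by fun_prop) h2s)
    (Continuous.integrable_of_hasCompactSupport (by fun_prop) h2s.mul_right)
    (fun x _ => (hφ.differentiable x).pow 2) (fun x _ => l.differentiableAt)
  simp only [hle, mul_one, hd2] at ibp
  have hI1 : Integrable fun x => ‖φ x‖ ^ 2 :=
    Continuous.integrable_of_hasCompactSupport (by fun_prop) (by simpa using h2s)
  have hI2 : Integrable fun x => ‖gradient φ x‖ ^ 2 :=
    Continuous.integrable_of_hasCompactSupport (by fun_prop)
      (hgs.comp_left (g := fun z : RN N => ‖z‖ ^ 2) (by simp))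
  -- Young's inequality with weight ½ on φ², which is absorbed on the left at the end; this produces
  -- the constant 4R².
  have key : ∫ x, ‖φ x‖ ^ 2 ≤ ∫ x, (1 / 2 * ‖φ x‖ ^ 2 + 2 * R ^ 2 * ‖gradient φ x‖ ^ 2) := by
    simp only [Real.norm_eq_abs, sq_abs]
    simp only [Real.norm_eq_abs, sq_abs] at hI1
    rw [ibp, ← integral_neg]
    refine integral_mono (Integrable.neg (Continuous.integrable_of_hasCompactSupport (by fun_prop)
      (hgs'.mul_left.mul_right))) ((hI1.const_mul _).add (hI2.const_mul _)) fun x => ?_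
    change -(2 * φ x * gradient φ x i * l x) ≤ 1 / 2 * φ x ^ 2 + 2 * R ^ 2 * ‖gradient φ x‖ ^ 2
    by_cases hx : x ∈ Ω
    · have h1 : |gradient φ x i| ≤ ‖gradient φ x‖ := PiLp.norm_apply_le (gradient φ x) i
      have h2 : |l x| ≤ R := (PiLp.norm_apply_le x i).trans (hR x hx)
      have h3 : |gradient φ x i * l x| ≤ ‖gradient φ x‖ * R := by
        rw [abs_mul]; gcongr
      have h4 : (gradient φ x i * l x) ^ 2 ≤ (‖gradient φ x‖ * R) ^ 2 := sq_le_sq'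
        (by linarith [neg_abs_le (gradient φ x i * l x)]) ((le_abs_self _).trans h3)
      nlinarith [sq_nonneg (φ x + 2 * (gradient φ x i * l x))]
    · rw [image_eq_zero_of_notMem_tsupport (fun h => hx (hφ.2.2 h))]
      simp only [mul_zero, zero_mul, neg_zero]
      positivity
  rw [integral_add (hI1.const_mul _) (hI2.const_mul _), integral_const_mul,
    integral_const_mul] at key
  linarith

theorem IsTestFun.zero_fun {N : ℕ} (Ω : Set (RN N)) : IsTestFun Ω (fun _ : RN N => (0 : ℝ)) :=
  ⟨contDiff_const, HasCompactSupport.zero, by simp [tsupport]⟩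

theorem IsTestFun.add {N : ℕ} {Ω : Set (RN N)} {φ ψ : RN N → ℝ} (h : IsTestFun Ω φ)
    (h' : IsTestFun Ω ψ) : IsTestFun Ω (fun x => φ x + ψ x) :=
  ⟨h.1.add h'.1, h.2.1.add h'.2.1,
    (tsupport_add φ ψ).trans (union_subset h.2.2 h'.2.2)⟩

theorem IsTestFun.const_mul {N : ℕ} {Ω : Set (RN N)} {φ : RN N → ℝ} (c : ℝ) (h : IsTestFun Ω φ) :
    IsTestFun Ω (fun x => c * φ x) :=
  ⟨contDiff_const.mul h.1, h.2.1.mul_left,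
    (tsupport_mul_subset_right (f := fun _ => c)).trans h.2.2⟩

theorem gradient_add_apply {N : ℕ} {φ ψ : RN N → ℝ} (h : Differentiable ℝ φ)
    (h' : Differentiable ℝ ψ) (x : RN N) :
    gradient (fun x => φ x + ψ x) x = gradient φ x + gradient ψ x := by
  simp only [gradient]
  rw [fderiv_fun_add (h x) (h' x), map_add]

theorem gradient_const_mul_apply {N : ℕ} {φ : RN N → ℝ} (c : ℝ) (h : Differentiable ℝ φ)
    (x : RN N) : gradient (fun x => c * φ x) x = c • gradient φ x := by
  simp only [gradient]
  rw [fderiv_const_mul (h x), map_smul]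

/-- The Poincaré inequality on `H₀¹(Ω)`, for `Ω` contained in a ball. -/
theorem H10.poincare {N : ℕ} (hN : 0 < N) {Ω : Set (RN N)} {R : ℝ}
    (hR : ∀ x ∈ Ω, ‖x‖ ≤ R) {p : JetL2 N Ω} (hp : p ∈ H10 Ω) :
    ‖p.fst‖ ^ 2 ≤ 4 * R ^ 2 * ‖p.snd‖ ^ 2 := by
  have hclosed : IsClosed {p : JetL2 N Ω | ‖p.fst‖ ^ 2 ≤ 4 * R ^ 2 * ‖p.snd‖ ^ 2} := by
    have c1 : Continuous fun p : JetL2 N Ω => p.fst := (WithLp.fstL 2 ℝ _ _).continuous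
    have c2 : Continuous fun p : JetL2 N Ω => p.snd := (WithLp.sndL 2 ℝ _ _).continuous
    exact isClosed_le (by fun_prop) (by fun_prop)
  refine closure_minimal ?_ hclosed hp
  intro q hq
  -- Jets of test functions are already closed under linear combinations, so the span adds nothing.
  have hq' : ∃ φ : RN N → ℝ, IsTestFun Ω φ ∧
      q.fst =ᵐ[volume.restrict Ω] φ ∧ q.snd =ᵐ[volume.restrict Ω] gradient φ := by
    refine Submodule.span_induction (p := fun q _ => ∃ φ : RN N → ℝ, IsTestFun Ω φ ∧
      q.fst =ᵐ[volume.restrict Ω] φ ∧ q.snd =ᵐ[volume.restrict Ω] gradient φ)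
      (fun q h => h) ?_ ?_ ?_ hq
    · refine ⟨_, IsTestFun.zero_fun Ω, Lp.coeFn_zero _ _ _, ?_⟩
      refine (Lp.coeFn_zero _ _ _).trans (Eventually.of_forall fun x => ?_)
      simp [gradient]
    · rintro p q - - ⟨φ, h, h1, h2⟩ ⟨ψ, h', h1', h2'⟩
      refine ⟨_, h.add h', (Lp.coeFn_add p.fst q.fst).trans (h1.add h1'),
        (Lp.coeFn_add p.snd q.snd).trans ?_⟩
      filter_upwards [h2, h2'] with x a b
      rw [gradient_add_apply h.differentiable h'.differentiable, Pi.add_apply, a, b]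
    · rintro c p - ⟨φ, h, h1, h2⟩
      refine ⟨_, h.const_mul c, (Lp.coeFn_smul c p.fst).trans (h1.const_smul c),
        (Lp.coeFn_smul c p.snd).trans ?_⟩
      filter_upwards [h2] with x a
      rw [gradient_const_mul_apply c h.differentiable, Pi.smul_apply, a]
  obtain ⟨φ, hφ, h1, h2⟩ := hq'
  have e1 : ‖q.fst‖ ^ 2 = ∫ x, ‖φ x‖ ^ 2 := by
    rw [norm_sq_eq_integral_L2, integral_congr_ae (g := fun x => ‖φ x‖ ^ 2)
      (h1.mono fun x hx => by simp only [hx])]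
    refine setIntegral_eq_integral_of_forall_compl_eq_zero fun x hx => ?_
    rw [image_eq_zero_of_notMem_tsupport (fun h => hx (hφ.2.2 h))]; simp
  have e2 : ‖q.snd‖ ^ 2 = ∫ x, ‖gradient φ x‖ ^ 2 := by
    rw [norm_sq_eq_integral_L2, integral_congr_ae (g := fun x => ‖gradient φ x‖ ^ 2)
      (h2.mono fun x hx => by simp only [hx])]
    refine setIntegral_eq_integral_of_forall_compl_eq_zero fun x hx => ?_
    have : fderiv ℝ φ x = 0 := by
      by_contra h
      exact hx (hφ.2.2 (support_fderiv_subset ℝ h))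
    simp [gradient, this]
  change ‖q.fst‖ ^ 2 ≤ 4 * R ^ 2 * ‖q.snd‖ ^ 2
  rw [e1, e2]
  exact hφ.poincare hN hR

/-! ### Periodic functions on the unit cell -/

/-- The embedding `ℤ^N → ℝ^N`. -/
def latticeHom (N : ℕ) : (Fin N → ℤ) →+ RN N where
  toFun k := WithLp.toLp 2 fun i => (k i : ℝ)
  map_zero' := by ext i; simp
  map_add' k l := by ext i; simp

@[simp] theorem latticeHom_apply {N : ℕ} (k : Fin N → ℤ) (i : Fin N) :
    latticeHom N k i = (k i : ℝ) := rfl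

/-- The half-open unit cube with corner `c`. -/
def halfOpenCell {N : ℕ} (c : RN N) : Set (RN N) := {y | ∀ i, y i ∈ Ico (c i) (c i + 1)}

theorem measurableSet_halfOpenCell {N : ℕ} (c : RN N) : MeasurableSet (halfOpenCell c) := by
  have : halfOpenCell c = ⋂ i, (fun y : RN N => y i) ⁻¹' Ico (c i) (c i + 1) := by
    ext; simp [halfOpenCell]
  rw [this]
  exact MeasurableSet.iInter fun i => measurableSet_Ico.preimage
    (EuclideanSpace.proj (𝕜 := ℝ) i).continuous.measurable

theorem existsUnique_add_latticeHom_mem {N : ℕ} (c y : RN N) :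
    ∃! k : Fin N → ℤ, y + latticeHom N k ∈ halfOpenCell c := by
  have h : ∀ i, ∃! m : ℤ, y i + m • (1 : ℝ) ∈ Ico (c i) (c i + 1) := fun i =>
    existsUnique_add_zsmul_mem_Ico one_pos _ _
  choose k hk hk' using h
  refine ⟨k, fun i => by simpa using hk i, fun l hl => funext fun i => hk' i (l i) ?_⟩
  simpa using hl i

theorem isAddFundamentalDomain_halfOpenCell {N : ℕ} (c : RN N) :
    IsAddFundamentalDomain (latticeHom N).range (halfOpenCell c) := by
  refine IsAddFundamentalDomain.mk' (measurableSet_halfOpenCell c).nullMeasurableSet fun y => ?_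
  obtain ⟨k, hk, hk'⟩ := existsUnique_add_latticeHom_mem c y
  refine ⟨⟨latticeHom N k, k, rfl⟩, ?_, ?_⟩
  · change latticeHom N k + y ∈ _
    rwa [add_comm]
  · rintro ⟨_, l, rfl⟩ hl
    have : l = k := hk' l (by
      change y + latticeHom N l ∈ _
      rw [add_comm]
      exact hl)
    rw [this]

/-- The lattice vector that moves `y` into the cube with corner `0`. -/
def latticeShift {N : ℕ} (y : RN N) : Fin N → ℤ := (existsUnique_add_latticeHom_mem 0 y).choose

/-- The lattice translate of a point lying in the cube with corner 0 is unique, hence the same for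
all points of one lattice orbit. -/
theorem add_latticeShift_add {N : ℕ} (y : RN N) (k : Fin N → ℤ) :
    (latticeHom N k + y) + latticeHom N (latticeShift (latticeHom N k + y))
      = y + latticeHom N (latticeShift y) := by
  have h1 := (existsUnique_add_latticeHom_mem 0 y).choose_spec
  have h2 := (existsUnique_add_latticeHom_mem 0 (latticeHom N k + y)).choose_spec
  have h3 := h1.2 (k + latticeShift (latticeHom N k + y)) (by
    simp only [map_add]
    convert h2.1 using 1
    rw [add_comm (latticeHom N k) y, add_assoc]
    rfl)
  have h4 : k + latticeShift (latticeHom N k + y) = latticeShift y := h3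
  rw [← h4, map_add]
  abel

theorem IsYPeriodic.ae_forall {N : ℕ} {F : RN N → ℝ} (h : IsYPeriodic F) :
    ∀ᵐ y, ∀ k : Fin N → ℤ, F (y + latticeHom N k) = F y := ae_all_iff.2 h

/-- Two fundamental domains give the same integral for an invariant function. Periodicity holds only
almost everywhere, so F is first replaced by F', its value at the representative in the cube with
corner 0, which is invariant at every point. -/
theorem IsYPeriodic.setIntegral_halfOpenCell {N : ℕ} {F : RN N → ℝ} (h : IsYPeriodic F)
    (c d : RN N) : ∫ y in halfOpenCell c, F y = ∫ y in halfOpenCell d, F y := by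
  set F' : RN N → ℝ := fun y => F (y + latticeHom N (latticeShift y)) with hF'
  have hFF' : F =ᵐ[volume] F' := by
    filter_upwards [h.ae_forall] with y hy using (hy _).symm
  rw [integral_congr_ae (ae_restrict_of_ae hFF'), integral_congr_ae (ae_restrict_of_ae hFF')]
  have : Countable (latticeHom N).range := (countable_range (latticeHom N)).to_subtype
  refine (isAddFundamentalDomain_halfOpenCell c).setIntegral_eq
    (isAddFundamentalDomain_halfOpenCell d) ?_
  rintro ⟨_, k, rfl⟩ y
  change F ((latticeHom N k + y) + latticeHom N (latticeShift (latticeHom N k + y))) = _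
  rw [add_latticeShift_add]

/-- The corner `(-1/2, …, -1/2)` of the unit cell. -/
def cellCorner (N : ℕ) : RN N := WithLp.toLp 2 fun _ => -(1 / 2)

/-- The boxes differ by faces of measure zero. Half-open boxes tile the space exactly, which the
open cell does not. -/
theorem cellY_ae_eq (N : ℕ) : cellY N =ᵐ[volume] halfOpenCell (cellCorner N) := by
  have hmp := PiLp.volume_preserving_ofLp (Fin N)
  have h1 : (univ.pi fun _ : Fin N => Ioo (-(1 / 2) : ℝ) (1 / 2))
      =ᵐ[volume] univ.pi fun _ : Fin N => Ico (-(1 / 2) : ℝ) (1 / 2) :=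
    Measure.univ_pi_Ioo_ae_eq_Icc.trans Measure.univ_pi_Ico_ae_eq_Icc.symm
  have h2 := hmp.quasiMeasurePreserving.preimage_ae_eq h1
  have e1 : cellY N = WithLp.ofLp ⁻¹' univ.pi fun _ : Fin N => Ioo (-(1 / 2) : ℝ) (1 / 2) := by
    ext y; simp [cellY]
  have e2 : halfOpenCell (cellCorner N)
      = WithLp.ofLp ⁻¹' univ.pi fun _ : Fin N => Ico (-(1 / 2) : ℝ) (1 / 2) := by
    ext y
    simp only [halfOpenCell, cellCorner, mem_preimage, mem_univ_pi]
    norm_num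
  rw [e1, e2]
  exact h2

theorem isBounded_cellY (N : ℕ) : Bornology.IsBounded (cellY N) := by
  refine (PiLp.antilipschitzWith_ofLp 2 (fun _ : Fin N => ℝ)).isBounded_preimage
    (s := Set.pi univ fun _ => Ioo (-(1 / 2) : ℝ) (1 / 2))
    (Bornology.IsBounded.pi fun _ => Metric.isBounded_Ioo _ _) |>.subset ?_
  intro y hy i _
  exact hy i

instance isFiniteMeasure_restrict_cellY (N : ℕ) : IsFiniteMeasure (volume.restrict (cellY N)) :=
  ⟨by simpa using (isBounded_cellY N).measure_lt_top⟩

theorem isOpen_cellY (N : ℕ) : IsOpen (cellY N) := by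
  have : cellY N = ⋂ i, (fun y : RN N => y i) ⁻¹' Ioo (-(1 / 2)) (1 / 2) := by
    ext; simp [cellY]
  rw [this]
  exact isOpen_iInter_of_finite fun i => isOpen_Ioo.preimage
    (EuclideanSpace.proj (𝕜 := ℝ) i).continuous

theorem volume_cellY_ne_zero (N : ℕ) : volume (cellY N) ≠ 0 := by
  refine ((isOpen_cellY N).measure_pos volume ⟨0, fun i => ?_⟩).ne'
  norm_num

/-- The integral over the cell of a periodic function is invariant under translations. -/
theorem IsYPeriodic.setIntegral_cellY_add {N : ℕ} {F : RN N → ℝ} (h : IsYPeriodic F) (y : RN N) :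
    ∫ z in cellY N, F (y + z) = ∫ z in cellY N, F z := by
  rw [setIntegral_congr_set (cellY_ae_eq N), setIntegral_congr_set (cellY_ae_eq N),
    h.setIntegral_halfOpenCell (cellCorner N) (cellCorner N + y),
    ← integral_indicator (measurableSet_halfOpenCell _),
    ← integral_indicator (measurableSet_halfOpenCell _),
    ← integral_add_left_eq_self (μ := volume) ((halfOpenCell (cellCorner N + y)).indicator F) y]
  refine integral_congr_ae (Eventually.of_forall fun z => ?_)
  have : y + z ∈ halfOpenCell (cellCorner N + y) ↔ z ∈ halfOpenCell (cellCorner N) := by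
    simp only [halfOpenCell, mem_ofPred_eq, PiLp.add_apply, mem_Ico]
    refine forall_congr' fun i => ?_
    constructor <;> rintro ⟨a, b⟩ <;> constructor <;> linarith
  beta_reduce
  by_cases hz : z ∈ halfOpenCell (cellCorner N)
  · rw [indicator_of_mem hz, indicator_of_mem (this.2 hz)]
  · rw [indicator_of_notMem hz, indicator_of_notMem (mt this.1 hz)]

theorem IsTestFun.comp_sub {N : ℕ} {φ : RN N → ℝ} (h : IsTestFun univ φ) (z : RN N) :
    IsTestFun univ fun y => φ (y - z) :=
  ⟨h.1.comp (contDiff_id.sub contDiff_const),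
    h.2.1.comp_homeomorph (Homeomorph.subRight z), subset_univ _⟩

theorem gradient_comp_sub {N : ℕ} (φ : RN N → ℝ) (z y : RN N) :
    gradient (fun y => φ (y - z)) y = gradient φ (y - z) := by
  simp only [gradient, fderiv_comp_sub]

/-- Translating the test function instead yields the weak gradient identity for every translate of
w, ready to be averaged over the cell. -/
theorem IsH1loc.weakGrad_translate {N : ℕ} {w : RN N → ℝ} {G : RN N → RN N} (h : IsH1loc w G)
    {φ : RN N → ℝ} (hφ : IsTestFun univ φ) (i : Fin N) (z : RN N) :
    ∫ y, w (y + z) * gradient φ y i = - ∫ y, G (y + z) i * φ y := by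
  have := h.weakGrad _ (hφ.comp_sub z) i
  simp only [gradient_comp_sub] at this
  rw [← integral_add_right_eq_self (μ := volume) (fun y => w y * gradient φ (y - z) i) z,
    ← integral_add_right_eq_self (μ := volume) (fun y => G y i * φ (y - z)) z] at this
  simpa only [add_sub_cancel_right] using this

theorem IsH1loc.locallyIntegrable_grad_apply {N : ℕ} {w : RN N → ℝ} {G : RN N → RN N}
    (h : IsH1loc w G) (i : Fin N) : LocallyIntegrable (fun y => G y i) := by
  rw [locallyIntegrable_iff]
  intro K hK
  exact (EuclideanSpace.proj (𝕜 := ℝ) i).integrable_comp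
    (locallyIntegrable_iff.1 h.memL2loc_grad.locallyIntegrable K hK)

theorem locallyIntegrable_comp_add {N : ℕ} {F : RN N → ℝ} (h : LocallyIntegrable F) (z : RN N) :
    LocallyIntegrable fun y => F (y + z) := by
  rw [locallyIntegrable_iff] at h ⊢
  intro K hK
  have h1 := h ((fun y => y + z) '' K) (hK.image (by fun_prop))
  have := (measurePreserving_add_right volume z).integrableOn_image
    (measurableEmbedding_addRight z) (f := F) (s := K)
  exact this.1 h1

/-- The weak gradient of a periodic function is periodic. -/
theorem IsH1loc.isYPeriodic_grad {N : ℕ} {w : RN N → ℝ} {G : RN N → RN N} (h : IsH1loc w G)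
    (hw : IsYPeriodic w) (i : Fin N) : IsYPeriodic fun y => G y i := by
  intro k
  -- G(· + k) and G are weak gradients of the same function w(· + k) = w, so they agree against all
  -- test functions.
  refine ae_eq_of_integral_contDiff_smul_eq
    (locallyIntegrable_comp_add (h.locallyIntegrable_grad_apply i) _)
    (h.locallyIntegrable_grad_apply i) fun φ hφ hφ' => ?_
  have ht : IsTestFun univ φ := ⟨hφ, hφ', subset_univ _⟩
  have h1 := h.weakGrad_translate ht i (WithLp.toLp 2 fun i => (k i : ℝ))
  have h2 := h.weakGrad φ ht i
  have h3 : ∫ y, w (y + WithLp.toLp 2 fun i => (k i : ℝ)) * gradient φ y i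
      = ∫ y, w y * gradient φ y i :=
    integral_congr_ae ((hw k).mono fun y hy => by simp only [hy])
  simp only [smul_eq_mul, mul_comm (φ _)]
  linarith

/-- Fubini's theorem for the cell average of `∫ F(y + z) ψ(y) dy`. -/
theorem integral_cellY_integral_translate {N : ℕ} {F : RN N → ℝ} (hF : LocallyIntegrable F)
    (hper : IsYPeriodic F) {ψ : RN N → ℝ} (hψ : Continuous ψ) (hψc : HasCompactSupport ψ) :
    ∫ z in cellY N, ∫ y, F (y + z) * ψ y = (∫ z in cellY N, F z) * ∫ y, ψ y := by
  obtain ⟨M, hM⟩ := hψ.bounded_above_of_compact_support hψc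
  -- K contains every y + z that contributes, so F may be truncated to K, where it is integrable.
  set K : Set (RN N) := tsupport ψ + closure (cellY N) with hKdef
  have hK : IsCompact K := hψc.isCompact.add (isBounded_cellY N).isCompact_closure
  have hmp : MeasurePreserving (fun p : RN N × RN N => (p.1, p.2 + p.1))
      ((volume.restrict (cellY N)).prod volume) ((volume.restrict (cellY N)).prod volume) :=
    (MeasurePreserving.id _).skew_product (g := fun r t => t + r) (by fun_prop)
      (Eventually.of_forall fun r => (measurePreserving_add_right volume r).map_eq)
  have hKi : Integrable (K.indicator F) :=
    (integrable_indicator_iff hK.measurableSet).2 (locallyIntegrable_iff.1 hF K hK)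
  have hint : Integrable (fun p : RN N × RN N => F (p.2 + p.1) * ψ p.2)
      ((volume.restrict (cellY N)).prod volume) := by
    have h1 : Integrable (fun p : RN N × RN N => ‖K.indicator F (p.2 + p.1)‖ * M)
        ((volume.restrict (cellY N)).prod volume) :=
      (hmp.integrable_comp_of_integrable (g := fun p : RN N × RN N => ‖K.indicator F p.2‖)
        (hKi.norm.comp_snd _)).mul_const M
    have hFm : AEStronglyMeasurable (fun p : RN N × RN N => F (p.2 + p.1))
        ((volume.restrict (cellY N)).prod volume) :=
      (hF.aestronglyMeasurable.comp_snd (μ := volume.restrict (cellY N))).comp_quasiMeasurePreserving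
        hmp.quasiMeasurePreserving
    refine h1.mono' (hFm.mul (hψ.comp continuous_snd).aestronglyMeasurable) ?_
    have hmem : ∀ᵐ p : RN N × RN N ∂((volume.restrict (cellY N)).prod volume), p.1 ∈ cellY N :=
      Measure.quasiMeasurePreserving_fst.ae (ae_restrict_mem (isOpen_cellY N).measurableSet)
    filter_upwards [hmem] with p hp
    rw [norm_mul]
    by_cases hs : p.2 ∈ tsupport ψ
    · rw [indicator_of_mem (add_mem_add hs (subset_closure hp))]
      exact mul_le_mul_of_nonneg_left (hM _) (norm_nonneg _)
    · rw [image_eq_zero_of_notMem_tsupport hs, norm_zero, mul_zero]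
      exact mul_nonneg (norm_nonneg _) ((norm_nonneg _).trans (hM 0))
  rw [integral_integral_swap hint, ← integral_const_mul]
  refine integral_congr_ae (Eventually.of_forall fun y => ?_)
  simp only []
  rw [integral_mul_const, hper.setIntegral_cellY_add y]

theorem exists_isTestFun_integral_eq_one (N : ℕ) :
    ∃ φ : RN N → ℝ, IsTestFun univ φ ∧ ∫ y, φ y = 1 := by
  let f : ContDiffBump (0 : RN N) := ⟨1, 2, one_pos, one_lt_two⟩
  exact ⟨f.normed volume, ⟨f.contDiff_normed, f.hasCompactSupport_normed, subset_univ _⟩,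
    f.integral_normed⟩

/-- The gradient of a periodic function of mean zero has mean zero on the cell. -/
theorem IsH1loc.integral_cellY_grad {N : ℕ} {w : RN N → ℝ} {G : RN N → RN N} (h : IsH1loc w G)
    (hw : IsYPeriodic w) (h0 : ∫ y in cellY N, w y = 0) (i : Fin N) :
    ∫ y in cellY N, G y i = 0 := by
  obtain ⟨φ, hφ, hφ1⟩ := exists_isTestFun_integral_eq_one N
  -- Average the translated identity over z ∈ Y: the side with w factors through ∫_Y w = 0, the
  -- other is -∫_Y Gᵢ because ∫ φ = 1.
  have h1 := integral_cellY_integral_translate (h.locallyIntegrable_grad_apply i)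
    (h.isYPeriodic_grad hw i) hφ.1.continuous hφ.2.1
  have h2 := integral_cellY_integral_translate h.memL2loc.locallyIntegrable hw
    (ψ := fun y => gradient φ y i)
    ((EuclideanSpace.proj (𝕜 := ℝ) i).continuous.comp hφ.continuous_gradient)
    (hφ.hasCompactSupport_gradient.comp_left (g := fun z : RN N => z i) rfl)
  simp only [h.weakGrad_translate hφ i, integral_neg, h0, zero_mul, h1, hφ1, mul_one] at h2
  linarith

/-- A periodic function of mean zero whose weak gradient vanishes is zero. -/
theorem IsH1loc.ae_eq_zero_of_grad_eq_zero {N : ℕ} {w : RN N → ℝ} {G : RN N → RN N}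
    (h : IsH1loc w G) (hw : IsYPeriodic w) (h0 : ∫ y in cellY N, w y = 0)
    (hG : ∀ᵐ y, G y = 0) : ∀ᵐ y, w y = 0 := by
  refine ae_eq_zero_of_integral_contDiff_smul_eq_zero h.memL2loc.locallyIntegrable
    fun φ hφ hφ' => ?_
  have ht : IsTestFun univ φ := ⟨hφ, hφ', subset_univ _⟩
  have hgrad : ∀ χ : RN N → ℝ, IsTestFun univ χ → ∀ i, ∫ y, w y * gradient χ y i = 0 := by
    intro χ hχ i
    rw [h.weakGrad χ hχ i, integral_congr_ae (g := fun _ => (0 : ℝ))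
      (hG.mono fun y hy => by simp [hy])]
    simp
  -- With the reflected test function, (w ∗ ψ)(z) = ∫ w(y + z) φ(y) dy. Its derivative tests w
  -- against gradients and vanishes, so it is constant; its cell average is (∫_Y w)(∫ φ) = 0, and z
  -- = 0 gives ∫ w φ = 0.
  set ψ : RN N → ℝ := fun y => φ (-y) with hψ
  have hψs : ContDiff ℝ ∞ ψ := hφ.comp contDiff_neg
  have hψc : HasCompactSupport ψ := hφ'.comp_homeomorph (Homeomorph.neg (RN N))
  set L := ContinuousLinearMap.mul ℝ ℝ with hL
  have hm : ∀ z, (convolution w ψ L volume) z = ∫ y, w (y + z) * φ y := by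
    intro z
    rw [convolution_def, ← integral_add_right_eq_self (μ := volume) _ z]
    refine integral_congr_ae (Eventually.of_forall fun y => ?_)
    simp [hL, hψ]
  have hderiv : ∀ z, HasFDerivAt (convolution w ψ L volume) (0 : RN N →L[ℝ] ℝ) z := by
    intro z
    have h1 := hψc.hasFDerivAt_convolution_right L h.memL2loc.locallyIntegrable
      (hψs.of_le (by simp)) z
    have hex := (hψc.fderiv (𝕜 := ℝ)).convolutionExists_right (L.precompR (RN N))
      h.memL2loc.locallyIntegrable (hψs.continuous_fderiv (by simp)) z
    have e : (convolution w (fderiv ℝ ψ) (L.precompR (RN N)) volume) z = 0 := by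
      refine ContinuousLinearMap.coe_injective
        ((EuclideanSpace.basisFun (Fin N) ℝ).toBasis.ext fun i => ?_)
      rw [convolution_def, ContinuousLinearMap.coe_coe, ContinuousLinearMap.integral_apply hex]
      have h2 := hgrad _ (ht.comp_sub z) i
      refine (integral_congr_ae (Eventually.of_forall fun t => ?_)).trans
        ((integral_neg _).trans (neg_eq_zero.2 h2))
      simp only [gradient_comp_sub]
      rw [← fderiv_single_eq_gradient (ht.differentiable _)]
      have h3 : fderiv ℝ ψ (z - t) = -fderiv ℝ φ (t - z) := by
        have h4 : HasFDerivAt φ (fderiv ℝ φ (-(z - t))) (-(z - t)) :=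
          (ht.differentiable _).hasFDerivAt
        have h5 := (h4.comp (z - t) (hasFDerivAt_id (𝕜 := ℝ) (z - t)).neg).fderiv
        rw [neg_sub] at h5
        refine h5.trans ?_
        ext v; simp
      simp [h3, hL]
    rw [e] at h1
    exact h1
  have hconst : ∀ z, (convolution w ψ L volume) z = (convolution w ψ L volume) 0 := fun z =>
    is_const_of_fderiv_eq_zero (fun x => (hderiv x).differentiableAt) (fun x => (hderiv x).fderiv) z 0
  have h1 := integral_cellY_integral_translate h.memL2loc.locallyIntegrable hw hφ.continuous hφ'
  simp only [← hm, hconst, h0, zero_mul] at h1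
  rw [setIntegral_const, smul_eq_mul, hm] at h1
  have h2 : volume.real (cellY N) ≠ 0 :=
    (ENNReal.toReal_ne_zero).2 ⟨volume_cellY_ne_zero N, (isBounded_cellY N).measure_lt_top.ne⟩
  simpa [h2, mul_comm] using h1

/-- Elements of `H¹_#(Y)` have gradients of mean zero. -/
theorem HSharp.integral_grad_eq_zero {N : ℕ} {p : JetL2 N (cellY N)} (hp : p ∈ HSharp N)
    (i : Fin N) : ∫ y in cellY N, p.snd y i = 0 := by
  obtain ⟨w, G, h, hper, hw, hG, h0⟩ := hp
  rw [integral_congr_ae hw] at h0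
  rw [integral_congr_ae (g := fun y => G y i) (hG.mono fun y hy => by simp only [hy])]
  exact h.integral_cellY_grad hper h0 i

/-- Every point has a lattice translate in the half-open cell, and the countably many translates of
a null set form a null set. -/
theorem IsYPeriodic.ae_eq_zero {N : ℕ} {F : RN N → ℝ} (h : IsYPeriodic F)
    (h0 : ∀ᵐ y ∂(volume.restrict (cellY N)), F y = 0) : ∀ᵐ y, F y = 0 := by
  have h1 : ∀ᵐ y, y ∈ halfOpenCell (cellCorner N) → F y = 0 := by
    rw [ae_restrict_iff' (isOpen_cellY N).measurableSet] at h0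
    filter_upwards [h0, (cellY_ae_eq N).mem_iff] with y a b c using a (b.2 c)
  have h2 : ∀ k : Fin N → ℤ, ∀ᵐ y, y + latticeHom N k ∈ halfOpenCell (cellCorner N) →
      F (y + latticeHom N k) = 0 := fun k =>
    (measurePreserving_add_right volume (latticeHom N k)).quasiMeasurePreserving.ae h1
  filter_upwards [ae_all_iff.2 h2, h.ae_forall] with y a b
  obtain ⟨k, hk, -⟩ := existsUnique_add_latticeHom_mem (cellCorner N) y
  rw [← b k]
  exact a k hk

/-- An element of `H¹_#(Y)` with vanishing gradient is zero. -/
theorem HSharp.eq_zero_of_grad_eq_zero {N : ℕ} {p : JetL2 N (cellY N)} (hp : p ∈ HSharp N)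
    (hs : p.snd = 0) : p = 0 := by
  obtain ⟨w, G, h, hper, hw, hG, h0⟩ := hp
  rw [integral_congr_ae hw] at h0
  have hG0 : ∀ᵐ y, G y = 0 := by
    have h1 : ∀ i, ∀ᵐ y, G y i = 0 := fun i => by
      refine (h.isYPeriodic_grad hper i).ae_eq_zero ?_
      rw [hs] at hG
      filter_upwards [hG, Lp.coeFn_zero (RN N) 2 (volume.restrict (cellY N))] with y a b
      rw [← a, b]; rfl
    filter_upwards [ae_all_iff.2 h1] with y hy
    ext i; exact hy i
  have hw0 := h.ae_eq_zero_of_grad_eq_zero hper h0 hG0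
  have hf : p.fst = 0 := by
    refine Lp.ext ?_
    filter_upwards [hw, ae_restrict_of_ae hw0,
      Lp.coeFn_zero ℝ 2 (volume.restrict (cellY N))] with y a b c
    rw [a, b, c]; rfl
  exact WithLp.ofLp_injective 2 (Prod.ext hf hs)

/-! ### Measurability and slices of two-parameter functions -/

/-- Carathéodory functions composed with measurable functions are measurable. -/
theorem aestronglyMeasurable_caratheodory {X β : Type*} [NormedAddCommGroup X]
    [MeasurableSpace β] {ν : Measure β} {Ψ : X → β → ℝ}
    (hm : ∀ c, AEStronglyMeasurable (Ψ c) ν) (hc : ∀ t, Continuous fun c => Ψ c t) {f : β → X}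
    (hf : AEStronglyMeasurable f ν) : AEStronglyMeasurable (fun t => Ψ (f t) t) ν := by
  obtain ⟨g, hg, hfg⟩ := hf
  have h1 : AEStronglyMeasurable (fun t => Ψ (g t) t) ν := by
    -- For a simple function the composite is a finite sum of the Ψ x cut off to level sets;
    -- continuity in the first variable passes to the limit.
    refine aestronglyMeasurable_of_tendsto_ae atTop
      (f := fun n t => Ψ (hg.approx n t) t) (fun n => ?_)
      (Eventually.of_forall fun t => ((hc t).tendsto _).comp (hg.tendsto_approx t))
    have : (fun t => Ψ (hg.approx n t) t) = fun t =>
        ∑ x ∈ (hg.approx n).range, ((hg.approx n) ⁻¹' {x}).indicator (Ψ x) t := by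
      funext t
      rw [Finset.sum_eq_single (hg.approx n t)]
      · rw [indicator_of_mem (by simp)]
      · intro x _ hx
        exact indicator_of_notMem (fun h => hx h.symm) _
      · intro h
        exact absurd (SimpleFunc.mem_range_self _ t) h
    rw [this]
    exact Finset.aestronglyMeasurable_fun_sum _ fun x _ =>
      (hm x).indicator ((hg.approx n).measurableSet_preimage _)
  refine h1.congr ?_
  filter_upwards [hfg] with t ht
  rw [ht]

theorem integrable_bilin_L2 {α E F : Type*} [MeasurableSpace α] {μ : Measure α}
    [NormedAddCommGroup E] [NormedSpace ℝ E] [NormedAddCommGroup F] [NormedSpace ℝ F]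
    (B : E →L[ℝ] F →L[ℝ] ℝ) (f : Lp E 2 μ) (g : Lp F 2 μ) :
    Integrable (fun x => B (f x) (g x)) μ :=
  memLp_one_iff_integrable.1 (B.memLp_of_bilin 1 (Lp.memLp f) (Lp.memLp g))

theorem integrable_dual_apply {α V : Type*} [MeasurableSpace α] {μ : Measure α}
    [NormedAddCommGroup V] [NormedSpace ℝ V] (g : Lp (StrongDual ℝ V) 2 μ) (v : Lp V 2 μ) :
    Integrable (fun t => g t (v t)) μ :=
  integrable_bilin_L2 (ContinuousLinearMap.id ℝ (StrongDual ℝ V)) g v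

theorem ae_ae_swap_of_ae_prod {α β : Type*} [MeasurableSpace α] [MeasurableSpace β]
    {μ : Measure α} {ν : Measure β} [SFinite μ] [SFinite ν] {p : α × β → Prop}
    (h : ∀ᵐ z ∂(μ.prod ν), p z) : ∀ᵐ t ∂ν, ∀ᵐ x ∂μ, p (x, t) :=
  Measure.ae_ae_of_ae_prod (Measure.measurePreserving_swap.quasiMeasurePreserving.ae h)

section Slice

variable {α β E : Type*} [MeasurableSpace α] [NormedAddCommGroup E] {μ : Measure α}

open Classical in
/-- The slice `r(·, t)` of a function on a product, as an element of `L²` (zero if it is not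
square integrable). -/
def sliceLp (μ : Measure α) (r : α × β → E) (t : β) : Lp E 2 μ :=
  if h : MemLp (fun x => r (x, t)) 2 μ then h.toLp _ else 0

theorem sliceLp_coeFn {r : α × β → E} {t : β} (h : MemLp (fun x => r (x, t)) 2 μ) :
    sliceLp μ r t =ᵐ[μ] fun x => r (x, t) := by
  rw [sliceLp, dif_pos h]
  exact h.coeFn_toLp

variable [MeasurableSpace β] {ν : Measure β} [SFinite μ] [SFinite ν]

/-- Fubini for ‖r‖². Consequently the default value 0 in `sliceLp` is met only on a null set of t.
-/
theorem ae_memLp_slice {r : α × β → E} (hr : MemLp r 2 (μ.prod ν)) :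
    ∀ᵐ t ∂ν, MemLp (fun x => r (x, t)) 2 μ := by
  have h1 : ∀ᵐ t ∂ν, AEStronglyMeasurable (fun x => r (x, t)) μ :=
    hr.1.prod_swap.prodMk_left
  filter_upwards [h1, (hr.integrable_norm_pow (by norm_num)).prod_left_ae] with t a b
  exact (memLp_two_iff_integrable_sq_norm a).2 b

theorem integrable_norm_sliceLp_sq {r : α × β → E} (hr : MemLp r 2 (μ.prod ν)) :
    Integrable (fun t => ‖sliceLp μ r t‖ ^ 2) ν := by
  refine (hr.integrable_norm_pow (p := 2) (by norm_num)).integral_prod_right.congr ?_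
  filter_upwards [ae_memLp_slice hr] with t ht
  rw [norm_sq_eq_integral_L2]
  exact integral_congr_ae ((sliceLp_coeFn ht).mono fun x hx => by simp only [hx])

variable {V : Type*} [NormedAddCommGroup V] [NormedSpace ℝ V] [NormedSpace ℝ E]

/-- Integrability in time of a bounded bilinear form of two-parameter functions. -/
theorem integrable_lpPairing_slice (B : E →L[ℝ] E →L[ℝ] ℝ) (J : V →L[ℝ] Lp E 2 μ)
    {u v : β → V} (hu : MemLp u 2 ν) (hv : MemLp v 2 ν) {r s : α × β → E}
    (hr : MemLp r 2 (μ.prod ν)) (hs : MemLp s 2 (μ.prod ν)) :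
    Integrable (fun t => B.lpPairing μ 2 2 (J (u t) + sliceLp μ r t) (J (v t) + sliceLp μ s t))
      ν := by
  have hb : Integrable (fun t => ‖B.lpPairing μ 2 2‖ * ((‖J‖ * ‖u t‖) ^ 2 + ‖sliceLp μ r t‖ ^ 2
      + (‖J‖ * ‖v t‖) ^ 2 + ‖sliceLp μ s t‖ ^ 2)) ν := by
    have h1 := (hu.integrable_norm_pow (p := 2) (by norm_num)).const_mul (‖J‖ ^ 2)
    have h2 := (hv.integrable_norm_pow (p := 2) (by norm_num)).const_mul (‖J‖ ^ 2)
    simp only [mul_pow]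
    exact (((h1.add (integrable_norm_sliceLp_sq hr)).add h2).add
      (integrable_norm_sliceLp_sq hs)).const_mul _
  refine hb.mono' ?_ (Eventually.of_forall fun t => ?_)
  · refine aestronglyMeasurable_caratheodory (X := V × V) (f := fun t => (u t, v t))
      (Ψ := fun c t => B.lpPairing μ 2 2 (J c.1 + sliceLp μ r t) (J c.2 + sliceLp μ s t))
      (fun c => ?_) (fun t => ?_) (hu.1.prodMk hv.1)
    · have hm : ∀ (c : V) {q : α × β → E}, MemLp q 2 (μ.prod ν) →
          AEStronglyMeasurable (fun p : α × β => J c p.1 + q p) (μ.prod ν) := fun c q hq =>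
        (Lp.aestronglyMeasurable (J c)).comp_fst.add hq.1
      have h2 := (B.aestronglyMeasurable_comp₂ (hm c.1 hr) (hm c.2 hs)).prod_swap.integral_prod_right'
      refine h2.congr ?_
      filter_upwards [ae_memLp_slice hr, ae_memLp_slice hs] with t hrt hst
      rw [ContinuousLinearMap.lpPairing_eq_integral]
      refine integral_congr_ae ?_
      filter_upwards [sliceLp_coeFn hrt, sliceLp_coeFn hst, Lp.coeFn_add (J c.1) (sliceLp μ r t),
        Lp.coeFn_add (J c.2) (sliceLp μ s t)] with x a b c d
      rw [c, d, Pi.add_apply, Pi.add_apply, a, b]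
      rfl
    · have h1 : Continuous fun c : V × V => J c.1 + sliceLp μ r t := by fun_prop
      have h2 : Continuous fun c : V × V => J c.2 + sliceLp μ s t := by fun_prop
      exact ((B.lpPairing μ 2 2).continuous.comp h1).clm_apply h2
  · refine ((B.lpPairing μ 2 2).le_opNorm₂ _ _).trans ?_
    rw [mul_assoc]
    refine mul_le_mul_of_nonneg_left ?_ (ContinuousLinearMap.opNorm_nonneg _)
    have h1 := (norm_add_le (J (u t)) (sliceLp μ r t)).trans
      (add_le_add_left (J.le_opNorm (u t)) _)
    have h2 := (norm_add_le (J (v t)) (sliceLp μ s t)).trans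
      (add_le_add_left (J.le_opNorm (v t)) _)
    refine (mul_le_mul h1 h2 (norm_nonneg _) (by positivity)).trans ?_
    generalize ‖J‖ * ‖u t‖ = a
    generalize ‖J‖ * ‖v t‖ = b
    nlinarith [sq_nonneg (a - b), sq_nonneg (‖sliceLp μ r t‖ - ‖sliceLp μ s t‖),
      sq_nonneg (a - ‖sliceLp μ s t‖), sq_nonneg (b - ‖sliceLp μ r t‖)]
end Slice

/-! ### The two-scale form on fibers: coercivity and definiteness -/

/-- `L²(Y)^N`. -/
abbrev L2Y (N : ℕ) : Type := Lp (RN N) 2 (volume.restrict (cellY N))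

/-- Multiplication by a bounded function on `L²(Y)`. -/
def mulCellCLM {N : ℕ} {a : RN N → ℝ} (ha : MemLp a ∞ volume) :
    Lp ℝ 2 (volume.restrict (cellY N)) →L[ℝ] Lp ℝ 2 (volume.restrict (cellY N)) :=
  (ContinuousLinearMap.mul ℝ ℝ).holderL (volume.restrict (cellY N)) ∞ 2 2 ((ha.restrict _).toLp a)

theorem mulCellCLM_coeFn {N : ℕ} {a : RN N → ℝ} (ha : MemLp a ∞ volume)
    (F : Lp ℝ 2 (volume.restrict (cellY N))) :
    mulCellCLM ha F =ᵐ[volume.restrict (cellY N)] fun y => a y * F y := by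
  have h := (ContinuousLinearMap.mul ℝ ℝ).coeFn_holder (r := 2) ((ha.restrict (cellY N)).toLp a) F
  filter_upwards [h, (ha.restrict (cellY N)).coeFn_toLp] with y h1 h2
  refine h1.trans ?_
  rw [h2]; rfl

/-- The bilinear form `(F, H) ↦ ∫_Y a F_j H_i`. -/
def cellForm {N : ℕ} {a : RN N → ℝ} (ha : MemLp a ∞ volume) (i j : Fin N) :
    L2Y N →L[ℝ] L2Y N →L[ℝ] ℝ :=
  ((ContinuousLinearMap.mul ℝ ℝ).lpPairing (volume.restrict (cellY N)) 2 2).bilinearComp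
    ((mulCellCLM ha).comp ((EuclideanSpace.proj (𝕜 := ℝ) j).compLpL 2 _))
    ((EuclideanSpace.proj (𝕜 := ℝ) i).compLpL 2 _)

theorem cellForm_apply {N : ℕ} {a : RN N → ℝ} (ha : MemLp a ∞ volume) (i j : Fin N)
    (F H : L2Y N) : cellForm ha i j F H = ∫ y in cellY N, a y * F y j * H y i := by
  rw [cellForm, ContinuousLinearMap.bilinearComp_apply, ContinuousLinearMap.lpPairing_eq_integral]
  refine integral_congr_ae ?_
  filter_upwards [mulCellCLM_coeFn ha ((EuclideanSpace.proj (𝕜 := ℝ) j).compLpL 2 _ F),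
    (EuclideanSpace.proj (𝕜 := ℝ) j).coeFn_compLpL (p := 2) F,
    (EuclideanSpace.proj (𝕜 := ℝ) i).coeFn_compLpL (p := 2) H] with y h1 h2 h3
  rw [ContinuousLinearMap.comp_apply, h1, h2, h3]
  rfl

theorem integrable_cellForm {N : ℕ} {a : RN N → ℝ} (ha : MemLp a ∞ volume) (i j : Fin N)
    (F H : L2Y N) : Integrable (fun y => a y * F y j * H y i) (volume.restrict (cellY N)) := by
  have h1 : ∀ (F : L2Y N) i, MemLp (fun y => F y i) 2 (volume.restrict (cellY N)) := fun F i =>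
    (EuclideanSpace.proj (𝕜 := ℝ) i).comp_memLp' (Lp.memLp F)
  have h2 : MemLp (fun y => a y * F y j) 2 (volume.restrict (cellY N)) :=
    (h1 F j).mul (ha.restrict _)
  exact h2.integrable_mul (h1 H i)

/-- Coercivity of the cell form. -/
theorem le_sum_cellForm {N : ℕ} {a : Fin N → Fin N → RN N → ℝ} (ha : ∀ i j, MemLp (a i j) ∞ volume)
    {α : ℝ} (hell : ∀ᵐ y : RN N, ∀ ζ : RN N, α * ‖ζ‖ ^ 2 ≤ ∑ i, ∑ j, a i j y * ζ j * ζ i)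
    (F : L2Y N) : α * ‖F‖ ^ 2 ≤ ∑ i, ∑ j, cellForm (ha i j) i j F F := by
  simp only [cellForm_apply]
  have h1 : ∑ i, ∑ j, ∫ y in cellY N, a i j y * F y j * F y i
      = ∫ y in cellY N, ∑ i, ∑ j, a i j y * F y j * F y i := by
    rw [integral_finsetSum _ fun i _ => integrable_finsetSum _ fun j _ =>
      integrable_cellForm (ha i j) i j F F]
    exact Finset.sum_congr rfl fun i _ =>
      (integral_finsetSum _ fun j _ => integrable_cellForm (ha i j) i j F F).symm
  rw [h1, norm_sq_eq_integral_L2, ← integral_const_mul]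
  refine integral_mono_ae (((Lp.memLp F).integrable_norm_pow (by norm_num)).const_mul α)
    (integrable_finsetSum _ fun i _ => integrable_finsetSum _ fun j _ =>
      integrable_cellForm (ha i j) i j F F) ?_
  filter_upwards [ae_restrict_of_ae hell] with y hy using hy (F y)

/-- `w ↦ ∇_y w^k`, from `V_Y` to `L²(Y)^N`. -/
def gradCellCLM {N : ℕ} (k : Fin N) : VY N →L[ℝ] L2Y N :=
  (WithLp.sndL 2 ℝ (Lp ℝ 2 (volume.restrict (cellY N))) (L2Y N)).comp
    ((HSharp N).subtypeL.comp ((PiLp.proj (𝕜 := ℝ) 2 (fun _ : Fin N => HSharp N) k).comp VY.incl))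

/-- The pointwise data `(∇u₀(x), u₁(x))` on which the two-scale form depends. -/
abbrev TwoScaleFiber (N : ℕ) : Type := (Fin N → RN N) × LperVY N

/-- The field `(c, W) ↦ (τ ↦ c_k + ∇_y W^k(τ))`. -/
def fiberGrad {N : ℕ} (k : Fin N) :
    TwoScaleFiber N →L[ℝ] Lp (L2Y N) 2 (volume : Measure UnitAddCircle) :=
  ((Lp.constL 2 volume ℝ).comp ((Lp.constL 2 (volume.restrict (cellY N)) ℝ).comp
    ((ContinuousLinearMap.proj k).comp (ContinuousLinearMap.fst ℝ _ _))))
  + ((gradCellCLM k).compLpL 2 volume).comp (ContinuousLinearMap.snd ℝ _ _)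

theorem fiberGrad_coeFn {N : ℕ} (k : Fin N) (p : TwoScaleFiber N) :
    ∀ᵐ τ, fiberGrad k p τ = Lp.const 2 (volume.restrict (cellY N)) (p.1 k)
      + (p.2 τ).incl.grad k := by
  have h1 := Lp.coeFn_add (Lp.const 2 (volume : Measure UnitAddCircle)
    (Lp.const 2 (volume.restrict (cellY N)) (p.1 k))) ((gradCellCLM k).compLpL 2 volume p.2)
  filter_upwards [h1, Lp.coeFn_const 2 (volume : Measure UnitAddCircle)
    (Lp.const 2 (volume.restrict (cellY N)) (p.1 k)), (gradCellCLM k).coeFn_compLpL (p := 2) p.2]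
    with τ a b c
  refine a.trans ?_
  rw [Pi.add_apply, b, c]
  rfl

theorem fiberGrad_coeFn_coeFn {N : ℕ} (k : Fin N) (p : TwoScaleFiber N) :
    ∀ᵐ τ, ∀ᵐ y ∂(volume.restrict (cellY N)),
      fiberGrad k p τ y = p.1 k + (p.2 τ).incl.grad k y := by
  filter_upwards [fiberGrad_coeFn k p] with τ h
  rw [h]
  filter_upwards [Lp.coeFn_add (Lp.const 2 (volume.restrict (cellY N)) (p.1 k))
    ((p.2 τ).incl.grad k), Lp.coeFn_const 2 (volume.restrict (cellY N)) (p.1 k)] with y a b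
  rw [a, Pi.add_apply, b]; rfl

/-- The form `∬_{Y×Z} a (c^k_j + ∂_j W^k)(d^k_i + ∂_i X^k)`. -/
def fiberForm {N : ℕ} {a : RN N → ℝ} (ha : MemLp a ∞ volume) (i j k : Fin N) :
    TwoScaleFiber N →L[ℝ] TwoScaleFiber N →L[ℝ] ℝ :=
  ((cellForm ha i j).lpPairing (volume : Measure UnitAddCircle) 2 2).bilinearComp
    (fiberGrad k) (fiberGrad k)

theorem fiberForm_apply {N : ℕ} {a : RN N → ℝ} (ha : MemLp a ∞ volume) (i j k : Fin N)
    (p q : TwoScaleFiber N) : fiberForm ha i j k p q =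
      ∫ τ : UnitAddCircle, ∫ y in cellY N, a y * (p.1 k j + (p.2 τ).incl.grad k y j)
        * (q.1 k i + (q.2 τ).incl.grad k y i) := by
  rw [fiberForm, ContinuousLinearMap.bilinearComp_apply, ContinuousLinearMap.lpPairing_eq_integral]
  refine integral_congr_ae ?_
  filter_upwards [fiberGrad_coeFn_coeFn k p, fiberGrad_coeFn_coeFn k q] with τ h1 h2
  rw [cellForm_apply]
  refine integral_congr_ae ?_
  filter_upwards [h1, h2] with y a1 a2
  rw [a1, a2]
  rfl

/-- The two-scale form on fibers. -/
def twoScaleFiberForm {N : ℕ} {a : Fin N → Fin N → RN N → ℝ}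
    (ha : ∀ i j, MemLp (a i j) ∞ volume) : TwoScaleFiber N →L[ℝ] TwoScaleFiber N →L[ℝ] ℝ :=
  ∑ i, ∑ j, ∑ k, fiberForm (ha i j) i j k

theorem twoScaleFiberForm_apply {N : ℕ} {a : Fin N → Fin N → RN N → ℝ}
    (ha : ∀ i j, MemLp (a i j) ∞ volume) (p q : TwoScaleFiber N) :
    twoScaleFiberForm ha p q = ∑ i, ∑ j, ∑ k, fiberForm (ha i j) i j k p q := by
  simp [twoScaleFiberForm]

/-- The form does not couple different components k, so ellipticity applies to each field `fiberGrad
k p τ` separately. Only the combined gradient is controlled here; injectivity of `fiberGrad` later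
separates the two scales. -/
theorem le_twoScaleFiberForm {N : ℕ} {a : Fin N → Fin N → RN N → ℝ}
    (ha : ∀ i j, MemLp (a i j) ∞ volume) {α : ℝ}
    (hell : ∀ᵐ y : RN N, ∀ ζ : RN N, α * ‖ζ‖ ^ 2 ≤ ∑ i, ∑ j, a i j y * ζ j * ζ i)
    (p : TwoScaleFiber N) : α * ∑ k, ‖fiberGrad k p‖ ^ 2 ≤ twoScaleFiberForm ha p p := by
  rw [twoScaleFiberForm_apply, Finset.mul_sum]
  have h1 : ∑ i, ∑ j, ∑ k, fiberForm (ha i j) i j k p p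
      = ∑ k, ∑ i, ∑ j, fiberForm (ha i j) i j k p p :=
    (Finset.sum_congr rfl fun i _ => Finset.sum_comm).trans Finset.sum_comm
  rw [h1]
  refine Finset.sum_le_sum fun k _ => ?_
  have hI : ∀ i j, Integrable fun τ =>
      cellForm (ha i j) i j (fiberGrad k p τ) (fiberGrad k p τ) := fun i j =>
    integrable_bilin_L2 (cellForm (ha i j) i j) _ _
  have h2 : ∑ i, ∑ j, fiberForm (ha i j) i j k p p
      = ∫ τ, ∑ i, ∑ j, cellForm (ha i j) i j (fiberGrad k p τ) (fiberGrad k p τ) := by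
    rw [integral_finsetSum _ fun i _ => integrable_finsetSum _ fun j _ => hI i j]
    refine Finset.sum_congr rfl fun i _ => ?_
    rw [integral_finsetSum _ fun j _ => hI i j]
    refine Finset.sum_congr rfl fun j _ => ?_
    rw [fiberForm, ContinuousLinearMap.bilinearComp_apply,
      ContinuousLinearMap.lpPairing_eq_integral]
  rw [h2, norm_sq_eq_integral_L2, ← integral_const_mul]
  exact integral_mono (((Lp.memLp _).integrable_norm_pow (by norm_num)).const_mul α)
    (integrable_finsetSum _ fun i _ => integrable_finsetSum _ fun j _ => hI i j)
    fun τ => le_sum_cellForm ha hell _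

theorem VY.eq_zero_of_grad_eq_zero {N : ℕ} {w : VY N} (h : ∀ k, w.incl.grad k = 0) : w = 0 := by
  have h1 : w.incl = 0 := by
    refine PiLp.ext fun k => Subtype.ext ?_
    exact HSharp.eq_zero_of_grad_eq_zero (w.incl k).2 (h k)
  exact Subtype.ext h1

/-- The map `(c, W) ↦ c + ∇_y W` is injective. -/
theorem eq_zero_of_fiberGrad_eq_zero {N : ℕ} {p : TwoScaleFiber N} (h : ∀ k, fiberGrad k p = 0) :
    p = 0 := by
  have h1 : ∀ k, ∀ᵐ τ, p.1 k = 0 ∧ (p.2 τ).incl.grad k = 0 := by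
    intro k
    filter_upwards [fiberGrad_coeFn k p, fiberGrad_coeFn_coeFn k p,
      (Lp.eq_zero_iff_ae_eq_zero.1 (h k))] with τ a b c
    rw [c] at a b
    -- A constant equal to minus a periodic gradient: integrating over Y kills the gradient, hence
    -- the constant.
    have hy : ∀ᵐ y ∂(volume.restrict (cellY N)), p.1 k = - (p.2 τ).incl.grad k y := by
      filter_upwards [b, Lp.coeFn_zero (RN N) 2 (volume.restrict (cellY N))] with y a1 a2
      exact eq_neg_of_add_eq_zero_left (a1.symm.trans a2)
    have hc : p.1 k = 0 := by
      ext i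
      have h2 : ∫ y in cellY N, p.1 k i = ∫ y in cellY N, - (p.2 τ).incl.grad k y i :=
        integral_congr_ae (hy.mono fun y hy => by simp [hy])
      rw [integral_neg, setIntegral_const, smul_eq_mul] at h2
      have h3 : ∫ y in cellY N, (p.2 τ).incl.grad k y i = 0 :=
        HSharp.integral_grad_eq_zero ((p.2 τ).incl k).2 i
      rw [h3, neg_zero] at h2
      exact (mul_eq_zero.1 h2).resolve_left
        (ENNReal.toReal_ne_zero.2 ⟨volume_cellY_ne_zero N, (isBounded_cellY N).measure_lt_top.ne⟩)
    refine ⟨hc, ?_⟩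
    rw [hc, map_zero, zero_add] at a
    exact a.symm
  have h2 : ∀ᵐ τ : UnitAddCircle, ∀ k, p.1 k = 0 ∧ (p.2 τ).incl.grad k = 0 := ae_all_iff.2 h1
  refine Prod.ext (funext fun k => ?_) ?_
  · obtain ⟨τ, hτ⟩ := h2.exists
    exact (hτ k).1
  · refine Lp.eq_zero_iff_ae_eq_zero.2 ?_
    filter_upwards [h2] with τ hτ
    exact VY.eq_zero_of_grad_eq_zero fun k => (hτ k).2

/-! ### The two-scale form over Ω and its dependence on time -/

/-- `u ↦ ∇u^k`, from `V` to `L²(Ω)^N`. -/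
def gradCLM {N : ℕ} {Ω : Set (RN N)} (k : Fin N) : VDiv Ω →L[ℝ] Lp (RN N) 2 (volume.restrict Ω) :=
  (WithLp.sndL 2 ℝ (Lp ℝ 2 (volume.restrict Ω)) (Lp (RN N) 2 (volume.restrict Ω))).comp
    ((H10 Ω).subtypeL.comp ((PiLp.proj (𝕜 := ℝ) 2 (fun _ : Fin N => H10 Ω) k).comp VDiv.incl))

/-- `u ↦ (∇u, 0)`, from `V` to the square integrable fields of two-scale fibers. -/
def macroFiberCLM {N : ℕ} (Ω : Set (RN N)) :
    VDiv Ω →L[ℝ] Lp (TwoScaleFiber N) 2 (volume.restrict Ω) :=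
  ∑ k, (((ContinuousLinearMap.inl ℝ (Fin N → RN N) (LperVY N)).comp
    (ContinuousLinearMap.single ℝ (fun _ : Fin N => RN N) k)).compLpL 2 _).comp (gradCLM k)

theorem macroFiberCLM_coeFn {N : ℕ} {Ω : Set (RN N)} (u : VDiv Ω) :
    ∀ᵐ x ∂(volume.restrict Ω), macroFiberCLM Ω u x = (fun k => u.incl.grad k x, 0) := by
  have h1 : macroFiberCLM Ω u = ∑ k, ((ContinuousLinearMap.inl ℝ (Fin N → RN N) (LperVY N)).comp
    (ContinuousLinearMap.single ℝ (fun _ : Fin N => RN N) k)).compLpL 2 (volume.restrict Ω)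
      (gradCLM k u) := by
    simp [macroFiberCLM]
  have h2 : ∀ k, ∀ᵐ x ∂(volume.restrict Ω),
      ((ContinuousLinearMap.inl ℝ (Fin N → RN N) (LperVY N)).comp
      (ContinuousLinearMap.single ℝ (fun _ : Fin N => RN N) k)).compLpL 2 (volume.restrict Ω)
      (gradCLM k u) x = (Pi.single k (u.incl.grad k x), 0) := fun k =>
    ContinuousLinearMap.coeFn_compLpL (p := 2) _ (gradCLM k u)
  rw [h1]
  filter_upwards [Lp.coeFn_finsetSum Finset.univ fun k =>
    ((ContinuousLinearMap.inl ℝ (Fin N → RN N) (LperVY N)).comp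
    (ContinuousLinearMap.single ℝ (fun _ : Fin N => RN N) k)).compLpL 2 (volume.restrict Ω)
      (gradCLM k u), ae_all_iff.2 h2] with x a b
  rw [a, Finset.sum_apply]
  simp only [b]
  refine Prod.ext ?_ ?_
  · rw [Prod.fst_sum]
    exact Finset.univ_sum_single _
  · rw [Prod.snd_sum]
    exact Finset.sum_const_zero

/-- The two-scale form on square integrable fields of fibers. -/
def twoScaleForm {N : ℕ} (Ω : Set (RN N)) {a : Fin N → Fin N → RN N → ℝ}
    (ha : ∀ i j, MemLp (a i j) ∞ volume) : Lp (TwoScaleFiber N) 2 (volume.restrict Ω) →L[ℝ]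
      Lp (TwoScaleFiber N) 2 (volume.restrict Ω) →L[ℝ] ℝ :=
  (twoScaleFiberForm ha).lpPairing (volume.restrict Ω) 2 2

theorem twoScaleForm_apply {N : ℕ} (Ω : Set (RN N)) {a : Fin N → Fin N → RN N → ℝ}
    (ha : ∀ i j, MemLp (a i j) ∞ volume) (U U' : Lp (TwoScaleFiber N) 2 (volume.restrict Ω)) :
    twoScaleForm Ω ha U U' = ∫ x in Ω, twoScaleFiberForm ha (U x) (U' x) :=
  ContinuousLinearMap.lpPairing_eq_integral _ _ _

theorem twoScaleForm_sub_left {N : ℕ} (Ω : Set (RN N)) {a : Fin N → Fin N → RN N → ℝ}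
    (ha : ∀ i j, MemLp (a i j) ∞ volume) (U U' W : Lp (TwoScaleFiber N) 2 (volume.restrict Ω)) :
    twoScaleForm Ω ha (U - U') W = twoScaleForm Ω ha U W - twoScaleForm Ω ha U' W := by
  rw [map_sub, _root_.sub_apply]

theorem twoScaleForm_eq_sum {N : ℕ} (Ω : Set (RN N)) {a : Fin N → Fin N → RN N → ℝ}
    (ha : ∀ i j, MemLp (a i j) ∞ volume) (U U' : Lp (TwoScaleFiber N) 2 (volume.restrict Ω)) :
    twoScaleForm Ω ha U U'
      = ∑ i, ∑ j, ∑ k, ∫ x in Ω, fiberForm (ha i j) i j k (U x) (U' x) := by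
  have hI : ∀ i j k, Integrable (fun x => fiberForm (ha i j) i j k (U x) (U' x))
      (volume.restrict Ω) := fun i j k => integrable_bilin_L2 (fiberForm (ha i j) i j k) _ _
  rw [twoScaleForm_apply]
  simp only [twoScaleFiberForm_apply]
  rw [integral_finsetSum _ fun i _ => integrable_finsetSum _ fun j _ =>
    integrable_finsetSum _ fun k _ => hI i j k]
  refine Finset.sum_congr rfl fun i _ => ?_
  rw [integral_finsetSum _ fun j _ => integrable_finsetSum _ fun k _ => hI i j k]
  refine Finset.sum_congr rfl fun j _ => ?_
  rw [integral_finsetSum _ fun k _ => hI i j k]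

/-- The fiber `(∇u₀(t), u₁(·, t))` at time `t`. -/
def fiberAt {N : ℕ} {Ω : Set (RN N)} {T : ℝ} (u : F01 Ω T) (t : ℝ) :
    Lp (TwoScaleFiber N) 2 (volume.restrict Ω) :=
  macroFiberCLM Ω (u.1 t)
    + sliceLp (volume.restrict Ω) (fun p => ((0 : Fin N → RN N), u.2 p)) t

theorem memLp_microFiber {N : ℕ} {Ω : Set (RN N)} {T : ℝ} (u : F01 Ω T) :
    MemLp (fun p => ((0 : Fin N → RN N), u.2 p)) 2
      ((volume.restrict Ω).prod (timeMeasure T)) :=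
  (ContinuousLinearMap.inr ℝ (Fin N → RN N) (LperVY N)).comp_memLp' (Lp.memLp u.2)

theorem ae_fiberAt_coeFn {N : ℕ} {Ω : Set (RN N)} {T : ℝ} (u : F01 Ω T) :
    ∀ᵐ t ∂(timeMeasure T), ∀ᵐ x ∂(volume.restrict Ω),
      fiberAt u t x = (fun k => (u.1 t).incl.grad k x, u.2 (x, t)) := by
  filter_upwards [ae_memLp_slice (memLp_microFiber u)] with t ht
  filter_upwards [macroFiberCLM_coeFn (u.1 t),
    sliceLp_coeFn (r := fun p => ((0 : Fin N → RN N), u.2 p)) ht,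
    Lp.coeFn_add (macroFiberCLM Ω (u.1 t))
      (sliceLp (volume.restrict Ω) (fun p => ((0 : Fin N → RN N), u.2 p)) t)] with x a b c
  rw [fiberAt, c, Pi.add_apply, a, b, Prod.mk_add_mk, add_zero, zero_add]

/-- Neither representatives nor `sliceLp` are additive for every t, so linearity is recovered for
almost every t by comparing values at almost every x. -/
theorem ae_fiberAt_sub {N : ℕ} {Ω : Set (RN N)} {T : ℝ} (u u' : F01 Ω T) :
    ∀ᵐ t ∂(timeMeasure T), fiberAt (u - u') t = fiberAt u t - fiberAt u' t := by
  have h2 : ∀ᵐ t ∂(timeMeasure T), ∀ᵐ x ∂(volume.restrict Ω),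
      (u - u').2 (x, t) = u.2 (x, t) - u'.2 (x, t) :=
    ae_ae_swap_of_ae_prod (Lp.coeFn_sub u.2 u'.2)
  filter_upwards [ae_fiberAt_coeFn u, ae_fiberAt_coeFn u', ae_fiberAt_coeFn (u - u'), h2,
    Lp.coeFn_sub u.1 u'.1] with t a b c d e
  refine Lp.ext ?_
  have h3 : ∀ k, ∀ᵐ x ∂(volume.restrict Ω), ((u.1 t - u'.1 t).incl).grad k x
      = (u.1 t).incl.grad k x - (u'.1 t).incl.grad k x := fun k =>
    Lp.coeFn_sub ((u.1 t).incl.grad k) ((u'.1 t).incl.grad k)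
  filter_upwards [a, b, c, d, ae_all_iff.2 h3,
    Lp.coeFn_sub (fiberAt u t) (fiberAt u' t)] with x a b c d h3 h4
  rw [h4, Pi.sub_apply, a, b, c, d, Prod.mk_sub_mk]
  refine Prod.ext (funext fun k => ?_) rfl
  exact (congrArg (fun q : VDiv Ω => q.incl.grad k x) e).trans (h3 k)

set_option maxHeartbeats 1000000 in
/-- The two-scale form in terms of fibers. -/
theorem aHat_eq {N : ℕ} {Ω : Set (RN N)} {a : Fin N → Fin N → RN N → ℝ}
    (ha : ∀ i j, MemLp (a i j) ∞ volume) {u₀ v₀ : VDiv Ω} {u₁ v₁ : RN N → LperVY N}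
    {U U' : Lp (TwoScaleFiber N) 2 (volume.restrict Ω)}
    (hU : ∀ᵐ x ∂(volume.restrict Ω), U x = (fun k => u₀.incl.grad k x, u₁ x))
    (hU' : ∀ᵐ x ∂(volume.restrict Ω), U' x = (fun k => v₀.incl.grad k x, v₁ x)) :
    aHat Ω a u₀ u₁ v₀ v₁ = twoScaleForm Ω ha U U' := by
  rw [twoScaleForm_eq_sum, aHat]
  refine Finset.sum_congr rfl fun i _ => Finset.sum_congr rfl fun j _ =>
    Finset.sum_congr rfl fun k _ => integral_congr_ae ?_
  filter_upwards [hU, hU'] with x h1 h2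
  rw [fiberForm_apply, h1, h2]

theorem ae_aHat_eq {N : ℕ} {Ω : Set (RN N)} {T : ℝ} {a : Fin N → Fin N → RN N → ℝ}
    (ha : ∀ i j, MemLp (a i j) ∞ volume) (u v : F01 Ω T) :
    ∀ᵐ t ∂(timeMeasure T), aHat Ω a (u.1 t) (fun x => u.2 (x, t)) (v.1 t) (fun x => v.2 (x, t))
      = twoScaleForm Ω ha (fiberAt u t) (fiberAt v t) :=
  (ae_fiberAt_coeFn u).mp ((ae_fiberAt_coeFn v).mono fun _ hv hu => aHat_eq ha hu hv)

theorem integrable_form_fiberAt {N : ℕ} {Ω : Set (RN N)} {T : ℝ} {a : Fin N → Fin N → RN N → ℝ}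
    (ha : ∀ i j, MemLp (a i j) ∞ volume) (u v : F01 Ω T) :
    Integrable (fun t => twoScaleForm Ω ha
      (fiberAt u t) (fiberAt v t)) (timeMeasure T) :=
  integrable_lpPairing_slice (twoScaleFiberForm ha) (macroFiberCLM Ω) (Lp.memLp u.1) (Lp.memLp v.1)
    (memLp_microFiber u) (memLp_microFiber v)

theorem form_self_nonneg {N : ℕ} {Ω : Set (RN N)} {a : Fin N → Fin N → RN N → ℝ}
    (ha : ∀ i j, MemLp (a i j) ∞ volume) {α : ℝ} (hα : 0 < α)
    (hell : ∀ᵐ y : RN N, ∀ ζ : RN N, α * ‖ζ‖ ^ 2 ≤ ∑ i, ∑ j, a i j y * ζ j * ζ i)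
    (U : Lp (TwoScaleFiber N) 2 (volume.restrict Ω)) :
    0 ≤ twoScaleForm Ω ha U U := by
  rw [twoScaleForm_apply]
  exact integral_nonneg fun x => le_trans (by positivity) (le_twoScaleFiberForm ha hell (U x))

/-- The integrand is nonnegative with zero integral, so it vanishes almost everywhere; fiberwise
coercivity and injectivity of the combined gradient then act at each such x. -/
theorem eq_zero_of_form_self_eq_zero {N : ℕ} {Ω : Set (RN N)} {a : Fin N → Fin N → RN N → ℝ}
    (ha : ∀ i j, MemLp (a i j) ∞ volume) {α : ℝ} (hα : 0 < α)
    (hell : ∀ᵐ y : RN N, ∀ ζ : RN N, α * ‖ζ‖ ^ 2 ≤ ∑ i, ∑ j, a i j y * ζ j * ζ i)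
    {U : Lp (TwoScaleFiber N) 2 (volume.restrict Ω)}
    (h : twoScaleForm Ω ha U U = 0) :
    ∀ᵐ x ∂(volume.restrict Ω), U x = 0 := by
  rw [twoScaleForm_apply, integral_eq_zero_iff_of_nonneg
    (fun x => le_trans (by positivity) (le_twoScaleFiberForm ha hell (U x)))
    (integrable_bilin_L2 (twoScaleFiberForm ha) U U)] at h
  filter_upwards [h] with x hx
  refine eq_zero_of_fiberGrad_eq_zero fun k => ?_
  have h1 := le_twoScaleFiberForm ha hell (U x)
  rw [hx] at h1
  have h2 : ∑ k, ‖fiberGrad k (U x)‖ ^ 2 ≤ 0 := by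
    by_contra h3
    rw [not_le] at h3
    exact absurd h1 (not_le.2 (mul_pos hα h3))
  have h4 := (Finset.single_le_sum (f := fun k => ‖fiberGrad k (U x)‖ ^ 2)
    (fun k _ => by positivity) (Finset.mem_univ k)).trans h2
  simpa using pow_eq_zero_iff two_ne_zero |>.1 (le_antisymm h4 (by positivity))

/-! ### The pivot space L²(Ω)^N and weak time derivatives -/

/-- Components of `u ∈ V` as an element of `L²(Ω)^N`. -/
def VDiv.toL2 {N : ℕ} {Ω : Set (RN N)} (u : VDiv Ω) :
    PiLp 2 (fun _ : Fin N => Lp ℝ 2 (volume.restrict Ω)) :=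
  WithLp.toLp 2 fun k => u.incl.comp k

theorem VDiv.inner_toL2 {N : ℕ} {Ω : Set (RN N)} (u v : VDiv Ω) :
    ⟪u.toL2, v.toL2⟫ = VDiv.innerL2 u v := by
  rw [PiLp.inner_apply]; rfl

theorem VDiv.innerL2_sub_left {N : ℕ} {Ω : Set (RN N)} (u u' v : VDiv Ω) :
    VDiv.innerL2 (u - u') v = VDiv.innerL2 u v - VDiv.innerL2 u' v := by
  simp only [VDiv.innerL2, ← Finset.sum_sub_distrib]
  refine Finset.sum_congr rfl fun k _ => ?_
  rw [← inner_sub_left]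
  rfl

/-- An element of `V` with vanishing gradient is zero. -/
theorem VDiv.eq_zero_of_grad_eq_zero {N : ℕ} (hN : 0 < N) {Ω : Set (RN N)}
    (hΩ : Bornology.IsBounded Ω) {u : VDiv Ω} (h : ∀ k, u.incl.grad k = 0) : u = 0 := by
  obtain ⟨R, hR⟩ := hΩ.exists_norm_le
  have h1 : u.incl = 0 := by
    refine PiLp.ext fun k => Subtype.ext ?_
    have h2 := H10.poincare hN hR (u.incl k).2
    have h3 : (u.incl k : JetL2 N Ω).snd = 0 := h k
    rw [h3, norm_zero] at h2
    have h4 : (u.incl k : JetL2 N Ω).fst = 0 := by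
      have : ‖(u.incl k : JetL2 N Ω).fst‖ ^ 2 = 0 := le_antisymm (by simpa using h2) (by positivity)
      simpa using this
    exact WithLp.ofLp_injective 2 (Prod.ext h4 h3)
  exact Subtype.ext h1

/-- `u ↦ u^k`, from `V` to `L²(Ω)`. -/
def compCLM {N : ℕ} {Ω : Set (RN N)} (k : Fin N) : VDiv Ω →L[ℝ] Lp ℝ 2 (volume.restrict Ω) :=
  (WithLp.fstL 2 ℝ (Lp ℝ 2 (volume.restrict Ω)) (Lp (RN N) 2 (volume.restrict Ω))).comp
    ((H10 Ω).subtypeL.comp ((PiLp.proj (𝕜 := ℝ) 2 (fun _ : Fin N => H10 Ω) k).comp VDiv.incl))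

theorem VDiv.integrable_innerL2 {N : ℕ} {Ω : Set (RN N)} {T : ℝ} (u : L2TV Ω T) (v : VDiv Ω) :
    Integrable (fun t => VDiv.innerL2 (u t) v) (timeMeasure T) :=
  integrable_finsetSum _ fun k _ =>
    ((innerSL ℝ (compCLM k v)).comp (compCLM k)).integrable_comp
      ((Lp.memLp u).integrable one_le_two) |>.congr
        (Eventually.of_forall fun t => real_inner_comm (compCLM k (u t)) (compCLM k v))

/-- Splitting the integrals requires integrability, which comes from boundedness of φ and φ' and
finiteness of the measure of ]0, T[. -/
theorem HasTimeDeriv.sub {N : ℕ} {Ω : Set (RN N)} {T : ℝ} {u u' : L2TV Ω T}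
    {g g' : L2TVdual Ω T} (h : HasTimeDeriv u g) (h' : HasTimeDeriv u' g') :
    HasTimeDeriv (u - u') (g - g') := by
  intro φ hφ v
  have hb : ∀ {q : ℝ → ℝ}, Continuous q → HasCompactSupport q → ∃ C, ∀ t, ‖q t‖ ≤ C :=
    fun hq hqc => hq.bounded_above_of_compact_support hqc
  have hφ' : Continuous (deriv φ) := hφ.1.continuous_deriv (by simp)
  obtain ⟨C, hC⟩ := hb hφ.1.continuous hφ.2.1
  obtain ⟨C', hC'⟩ := hb hφ' hφ.2.1.deriv
  have hI : ∀ u : L2TV Ω T, Integrable (fun t => deriv φ t * VDiv.innerL2 (u t) v)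
      (timeMeasure T) := fun u =>
    (VDiv.integrable_innerL2 u v).bdd_mul hφ'.aestronglyMeasurable (Eventually.of_forall hC')
  have hJ : ∀ g : L2TVdual Ω T, Integrable (fun t => φ t * g t v) (timeMeasure T) := fun g =>
    ((ContinuousLinearMap.apply ℝ ℝ v).integrable_comp
      ((Lp.memLp g).integrable one_le_two)).bdd_mul hφ.1.continuous.aestronglyMeasurable
      (Eventually.of_forall hC)
  have e1 : ∫ t in Ioo 0 T, deriv φ t * VDiv.innerL2 ((u - u') t) v
      = (∫ t in Ioo 0 T, deriv φ t * VDiv.innerL2 (u t) v)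
        - ∫ t in Ioo 0 T, deriv φ t * VDiv.innerL2 (u' t) v := by
    rw [← integral_sub (hI u) (hI u')]
    refine integral_congr_ae ?_
    filter_upwards [Lp.coeFn_sub u u'] with t ht
    rw [ht, Pi.sub_apply, VDiv.innerL2_sub_left, mul_sub]
  have e2 : ∫ t in Ioo 0 T, φ t * (g - g') t v
      = (∫ t in Ioo 0 T, φ t * g t v) - ∫ t in Ioo 0 T, φ t * g' t v := by
    rw [← integral_sub (hJ g) (hJ g')]
    refine integral_congr_ae ?_
    filter_upwards [Lp.coeFn_sub g g'] with t ht
    rw [ht, Pi.sub_apply, _root_.sub_apply, mul_sub]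
  rw [e1, e2, h φ hφ v, h' φ hφ v]
  ring

theorem HasZeroInitialValue.sub {N : ℕ} {Ω : Set (RN N)} {T : ℝ} {u u' : L2TV Ω T}
    (h : HasZeroInitialValue u) (h' : HasZeroInitialValue u') : HasZeroInitialValue (u - u') := by
  obtain ⟨c, hc, hc0, hcu⟩ := h
  obtain ⟨c', hc', hc0', hcu'⟩ := h'
  refine ⟨fun t => c t - c' t, hc.sub hc', by simp [hc0, hc0'], ?_⟩
  filter_upwards [hcu, hcu', Lp.coeFn_sub u u'] with t h1 h2 h3 k
  rw [h3, PiLp.sub_apply, h1 k, h2 k]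
  rfl

theorem HasTimeDeriv.integral_self_nonneg {N : ℕ} {Ω : Set (RN N)} {T : ℝ} (hT : 0 < T)
    {u : L2TV Ω T} {g : L2TVdual Ω T} (h : HasTimeDeriv u g) (h0 : HasZeroInitialValue u) :
    0 ≤ ∫ t in Ioo 0 T, g t (u t) := by
  obtain ⟨c, hc, hc0, hcu⟩ := h0
  refine integral_weakDeriv_apply_self_nonneg VDiv.toL2 hT (Lp.memLp u) (Lp.memLp g) ?_ hc hc0 ?_
  · intro φ hφ v
    simp only [VDiv.inner_toL2]
    exact h φ hφ v
  · filter_upwards [hcu] with t ht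
    exact PiLp.ext fun k => ht k

end

/-! ### Uniqueness -/

set_option maxHeartbeats 1000000 in
theorem lemma3p1 {N : ℕ} (hN : 0 < N) (Ω : Set (RN N)) (hΩ : IsOpen Ω)
    (hΩb : Bornology.IsBounded Ω) (T : ℝ) (hT : 0 < T)
    (a : Fin N → Fin N → RN N → ℝ) (ha : ∀ i j, MemLp (a i j) ∞ volume)
    (hsymm : ∀ i j, a i j =ᵐ[volume] a j i)
    (α : ℝ) (hα : 0 < α)
    (hell : ∀ᵐ y : RN N, ∀ ζ : RN N, α * ‖ζ‖ ^ 2 ≤ ∑ i, ∑ j, a i j y * ζ j * ζ i)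
    (f : Lp (Hm1N Ω) 2 (timeMeasure T)) (u u' : F01 Ω T)
    (hu : IsTwoScaleSolution Ω T a f u) (hu' : IsTwoScaleSolution Ω T a f u') :
    u = u' := by
  obtain ⟨g, hg, h0, hv⟩ := hu
  obtain ⟨g', hg', h0', hv'⟩ := hu'
  -- The difference is itself an admissible test function, used in both problems.
  set w : F01 Ω T := u - u' with hw
  have e1 := hv w
  have e2 := hv' w
  rw [integral_congr_ae (ae_aHat_eq ha u w)] at e1
  rw [integral_congr_ae (ae_aHat_eq ha u' w)] at e2
  have hgw : ∫ t in Ioo 0 T, (g - g') t (w.1 t)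
      = (∫ t in Ioo 0 T, g t (w.1 t)) - ∫ t in Ioo 0 T, g' t (w.1 t) := by
    rw [← integral_sub (integrable_dual_apply g w.1) (integrable_dual_apply g' w.1)]
    refine integral_congr_ae ?_
    filter_upwards [Lp.coeFn_sub g g'] with t ht
    rw [ht]; rfl
  have hBw : ∫ t in Ioo 0 T, twoScaleForm Ω ha (fiberAt w t) (fiberAt w t)
      = (∫ t in Ioo 0 T, twoScaleForm Ω ha (fiberAt u t) (fiberAt w t))
        - ∫ t in Ioo 0 T, twoScaleForm Ω ha (fiberAt u' t) (fiberAt w t) := by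
    rw [← integral_sub (integrable_form_fiberAt ha u w) (integrable_form_fiberAt ha u' w)]
    refine integral_congr_ae ?_
    filter_upwards [ae_fiberAt_sub u u'] with t ht
    exact (congrArg (fun U => twoScaleForm Ω ha U (fiberAt w t)) ht).trans
      (twoScaleForm_sub_left Ω ha _ _ _)
  have hpos : 0 ≤ ∫ t in Ioo 0 T, (g - g') t (w.1 t) :=
    (hg.sub hg').integral_self_nonneg hT (h0.sub h0')
  have hBnn : ∀ t, 0 ≤ twoScaleForm Ω ha (fiberAt w t) (fiberAt w t) := fun t =>
    form_self_nonneg ha hα hell _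
  -- The subtracted equations say that the time term and the form term add up to zero, and both are
  -- nonnegative.
  have hzero : ∫ t in Ioo 0 T, twoScaleForm Ω ha (fiberAt w t) (fiberAt w t) = 0 :=
    le_antisymm (by linarith) (integral_nonneg hBnn)
  rw [integral_eq_zero_iff_of_nonneg hBnn (integrable_form_fiberAt ha w w)] at hzero
  have hw0 : ∀ᵐ t ∂(timeMeasure T), ∀ᵐ x ∂(volume.restrict Ω),
      (∀ k, (w.1 t).incl.grad k x = 0) ∧ w.2 (x, t) = 0 := by
    filter_upwards [hzero, ae_fiberAt_coeFn w] with t ht ht'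
    filter_upwards [eq_zero_of_form_self_eq_zero ha hα hell ht, ht'] with x h1 h2
    rw [h1] at h2
    exact ⟨fun k => (congrFun (congrArg Prod.fst h2) k).symm, (congrArg Prod.snd h2).symm⟩
  -- At almost every t the gradients of all components vanish on Ω; Poincaré on the bounded set Ω
  -- concludes.
  have hw1 : w.1 = 0 := by
    refine Lp.eq_zero_iff_ae_eq_zero.2 ?_
    filter_upwards [hw0] with t ht
    refine VDiv.eq_zero_of_grad_eq_zero hN hΩb fun k => Lp.eq_zero_iff_ae_eq_zero.2 ?_
    filter_upwards [ht] with x hx using hx.1 k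
  have hw2 : w.2 = 0 := by
    have h1 : ‖w.2‖ ^ 2 = 0 := by
      rw [norm_sq_eq_integral_L2,
        -- Fubini with t as the outer variable, matching the order of quantifiers in `hw0`.
        integral_prod_symm _ ((Lp.memLp w.2).integrable_norm_pow (by norm_num))]
      refine integral_eq_zero_of_ae ?_
      filter_upwards [hw0] with t ht
      refine integral_eq_zero_of_ae ?_
      filter_upwards [ht] with x hx
      simp [hx.2]
    simpa using h1
  have : w = 0 := Prod.ext hw1 hw2
  exact sub_eq_zero.1 this
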